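/- Let $\mathcal Y$ be the class of non-plane, unlabelled, rooted binary trees: a tree is either a single external node, or a root to which an unordered pair of (not necessarily distinct) trees of $\mathcal Y$ is attached. The size of a tree is its number of external nodes, and its height is the maximal number of edges on a path from the root to an external node. Let $y_n$ be the number of trees of size $n$, let $y(z)=\sum_{n\ge 1}y_nz^n$, let $\rho$ be the radius of convergence of $y$, and for $n\ge 1$ let $H_n$ be the height of a tree chosen uniformly at random among the $y_n$ trees of size $n$. **Theorem (Very large deviations).** There is a continuous, strictly increasing function $I:[0,1]\to\mathbb R$ with $I(u)>0$ for $0<u\le 1$ such that, for every $\delta>0$, there is a constant $K$ depending only on $\delta$ with $$\mathbb P(H_n\ge xn)\le K\,n^{3/2}e^{-nI(x)}\qquad\text{for all }x\in[\delta,1-\delta]\text{ and all }n\ge 1 .$$ Moreover, for $x\in(0,1)$ the function $I$ is given explicitly by $$I(x)=\log\xi-\log\rho-x\log y(\xi),$$ where $\xi=\xi(x)$ is the unique solution in $(0,\rho)$ of the saddle-point equation $x\,\xi\,y'(\xi)=y(\xi)$. -/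

import Mathlib

open MeasureTheory ProbabilityTheory

/-- Two plane binary trees are equivalent when they agree up to swapping the two subtrees at
any number of internal nodes. -/
inductive BinaryTree.SwapEquiv : BinaryTree Unit → BinaryTree Unit → Prop
  | nil : SwapEquiv .nil .nil
  | node {l r l' r' : BinaryTree Unit} :
      SwapEquiv l l' → SwapEquiv r r' → SwapEquiv (.node () l r) (.node () l' r')
  | swap {l r l' r' : BinaryTree Unit} :
      SwapEquiv l r' → SwapEquiv r l' → SwapEquiv (.node () l r) (.node () l' r')

namespace BinaryTree.SwapEquiv

theorem refl : ∀ t : BinaryTree Unit, SwapEquiv t t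
  | .nil => .nil
  | .node () l r => .node (refl l) (refl r)

theorem symm {s t : BinaryTree Unit} (h : SwapEquiv s t) : SwapEquiv t s := by
  induction h with
  | nil => exact .nil
  | node _ _ h₁ h₂ => exact .node h₁ h₂
  | swap _ _ h₁ h₂ => exact .swap h₂ h₁

theorem trans {s t u : BinaryTree Unit} (h : SwapEquiv s t) (h' : SwapEquiv t u) :
    SwapEquiv s u := by
  induction h generalizing u with
  | nil => exact h'
  | node _ _ h₁ h₂ =>
    cases h' with
    | node k₁ k₂ => exact .node (h₁ k₁) (h₂ k₂)
    | swap k₁ k₂ => exact .swap (h₁ k₁) (h₂ k₂)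
  | swap _ _ h₁ h₂ =>
    cases h' with
    | node k₁ k₂ => exact .swap (h₁ k₂) (h₂ k₁)
    | swap k₁ k₂ => exact .node (h₁ k₂) (h₂ k₁)

theorem numLeaves_eq {s t : BinaryTree Unit} (h : SwapEquiv s t) : s.numLeaves = t.numLeaves := by
  induction h with
  | nil => rfl
  | node _ _ h₁ h₂ => simp [h₁, h₂]
  | swap _ _ h₁ h₂ => simp [h₁, h₂, Nat.add_comm]

theorem height_eq {s t : BinaryTree Unit} (h : SwapEquiv s t) : s.height = t.height := by
  induction h with
  | nil => rfl
  | node _ _ h₁ h₂ => simp [h₁, h₂]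
  | swap _ _ h₁ h₂ => simp [h₁, h₂, max_comm]

end BinaryTree.SwapEquiv

/-- Equivalence of plane binary trees up to reordering of subtrees. -/
def binaryTreeSetoid : Setoid (BinaryTree Unit) where
  r := BinaryTree.SwapEquiv
  iseqv := ⟨.refl, .symm, .trans⟩

/-- Non-plane, unlabelled, rooted binary trees: a tree is an external node, or a root with an
unordered pair of (not necessarily distinct) binary trees. -/
def NonplaneTree : Type := Quotient binaryTreeSetoid

namespace NonplaneTree

/-- The size of a tree: its number of external nodes. -/
def size : NonplaneTree → ℕ :=
  Quotient.lift BinaryTree.numLeaves fun _ _ h => BinaryTree.SwapEquiv.numLeaves_eq h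

/-- The height of a tree: the maximal number of edges on a path from the root to an external
node. -/
def height : NonplaneTree → ℕ :=
  Quotient.lift BinaryTree.height fun _ _ h => BinaryTree.SwapEquiv.height_eq h

/-- The set of trees of size `n`. -/
def ofSize (n : ℕ) : Set NonplaneTree := {t | t.size = n}

theorem finite_ofSize (n : ℕ) : (ofSize n).Finite := by
  refine ((BinaryTree.treesOfNumNodesEq (n - 1)).finite_toSet.image
    (Quotient.mk binaryTreeSetoid)).subset ?_
  intro t
  refine Quotient.inductionOn t fun s hs => ⟨s, ?_, rfl⟩
  have h : s.numLeaves = n := hs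
  rw [BinaryTree.numLeaves_eq_numNodes_succ] at h
  simp only [BinaryTree.coe_treesOfNumNodesEq, Set.mem_ofPred_eq]
  omega

theorem nonempty_ofSize {n : ℕ} (hn : 1 ≤ n) : (ofSize n).Nonempty := by
  suffices h : ∃ s : BinaryTree Unit, s.numLeaves = n from
    let ⟨s, hs⟩ := h
    ⟨Quotient.mk binaryTreeSetoid s, hs⟩
  induction n, hn using Nat.le_induction with
  | base => exact ⟨.nil, rfl⟩
  | succ n _ ih =>
    obtain ⟨s, hs⟩ := ih
    exact ⟨.node () s .nil, by simp [hs]⟩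

instance : MeasurableSpace NonplaneTree := ⊤

instance : DiscreteMeasurableSpace NonplaneTree := ⟨fun _ => trivial⟩

/-- The law of a random tree taken uniformly among the trees of size `n`. -/
noncomputable def uniformLaw (n : ℕ) : Measure NonplaneTree := uniformOn (ofSize n)

theorem isProbabilityMeasure_uniformLaw {n : ℕ} (hn : 1 ≤ n) :
    IsProbabilityMeasure (uniformLaw n) :=
  isProbabilityMeasure_uniformOn (finite_ofSize n) (nonempty_ofSize hn)

/-- The number `yₙ` of trees of size `n`. -/
noncomputable def count (n : ℕ) : ℕ := (ofSize n).ncard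

/-- The generating function `y(z) = ∑ yₙ zⁿ` on the real line. -/
noncomputable def genFun (z : ℝ) : ℝ := ∑' n : ℕ, (count n : ℝ) * z ^ n

/-- The radius of convergence `ρ` of the generating function `y`. -/
noncomputable def rho : ℝ :=
  (FormalMultilinearSeries.ofScalars ℝ (fun n => (count n : ℝ))).radius.toReal

end NonplaneTree

open scoped ENNReal NNReal
open Filter Topology

/-! The bound is a Chernoff estimate divided by a lower bound for `count n`. Splitting a tree at its
root gives `2 y(z) = 2 z + y(z)^2 + y(z^2)`, that is `(1 - y(z))^2 = 1 - 2 z - y(z^2)`. The same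
splitting, restricted by height, shows that the generating function `G_k` of trees of height at
least `k` satisfies `2 G_{k+1}(r) ≤ 2 y(r) G_k(r) + G_k(r^2)`. The last term is at most `r^(k+1)
G_k(r)`, so each level costs a factor `y(r) (1 + r^k / 2)`, and `G_k(r) ≤ e y(r)^k` for `0 ≤ r < ρ`
(`gfGe_le_exp_one`). One coefficient of `G_k` is then at most `e y(r)^k r^(-n)`.

For the denominator, `count n * ρ^n ≥ c n^(-3/2)` (`exists_pos_le_count`) is obtained without
singularity analysis. Since `2 ρ + y(ρ^2) = 1`, the series `F(z) = 2 ρ z + y(ρ^2 z^2)` is a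
probability law, and `Y(z) = y(ρ z)` satisfies `(1 - Y)^2 = 1 - F`. Hence `2 Y' = F' (1 -
F)^(-1/2)`; expanding in powers of `F` and comparing with the renewal sequence of `F`, which is
bounded below, gives the estimate.

Optimising over `r` produces the rate as a Legendre transform. Strict convexity of `u ↦ log y(e^u)`
makes the saddle point unique and optimal; the square-root equation forces `r y'(r) / y(r)` to cover
all of `(1, ∞)`, so it exists. -/

/-! ### Sums over fibres and over unordered pairs -/

theorem ENNReal.tsum_eq_tsum_encard_mul {α β : Type*} (f : α → β) (W : β → ℝ≥0∞) :
    ∑' a, W (f a) = ∑' b, ((f ⁻¹' {b}).encard : ℝ≥0∞) * W b := by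
  rw [← (Equiv.sigmaFiberEquiv f).tsum_eq, ENNReal.tsum_sigma']
  refine tsum_congr fun b => ?_
  rw [← ENNReal.tsum_set_const]
  refine tsum_congr fun a => ?_
  have := a.2
  simp only [Equiv.sigmaFiberEquiv_apply]
  rw [this]

/-- Ordered pairs together with one extra copy of the diagonal cover `Sym2 α` exactly two-to-one. -/
theorem Sym2.two_mul_tsum {α : Type*} (W : Sym2 α → ℝ≥0∞) :
    2 * ∑' q, W q = ∑' p : α × α, W s(p.1, p.2) + ∑' a, W s(a, a) := by
  classical
  let f : (α × α) ⊕ α → Sym2 α := Sum.elim (fun p => s(p.1, p.2)) fun a => s(a, a)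
  have h := ENNReal.tsum_eq_tsum_encard_mul f W
  rw [ENNReal.summable.tsum_sum ENNReal.summable] at h
  have key : ∀ q, (f ⁻¹' {q}).encard = 2 := by
    intro q
    induction q using Sym2.inductionOn with | _ a b => ?_
    by_cases hab : a = b
    · subst hab
      have : f ⁻¹' {s(a, a)} = {Sum.inl (a, a), Sum.inr a} := by
        ext x
        rcases x with ⟨c, d⟩ | c <;> simp [f]
      rw [this, Set.encard_pair (by simp)]
    · have : f ⁻¹' {s(a, b)} = {Sum.inl (a, b), Sum.inl (b, a)} := by
        ext x
        rcases x with ⟨c, d⟩ | c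
        · simp [f]
        · simp [f]
          exact ⟨fun h h' => hab (h.symm.trans h'), fun h h' => hab (h'.symm.trans h)⟩
      rw [this, Set.encard_pair (by simp [hab])]
  simp only [key] at h
  rw [ENNReal.tsum_mul_left] at h
  simpa [f] using h.symm

/-! ### Root decomposition and generating functions in `ℝ≥0∞` -/

namespace NonplaneTree

/-- The tree with a single external node. -/
def nil : NonplaneTree := Quotient.mk binaryTreeSetoid .nil

/-- The tree whose root carries an unordered pair of trees. -/
def node : Sym2 NonplaneTree → NonplaneTree :=
  Sym2.lift ⟨Quotient.map₂ (fun l r => .node () l r)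
    fun _ _ h₁ _ _ h₂ => BinaryTree.SwapEquiv.node h₁ h₂, by
      intro a b
      induction a using Quotient.inductionOn
      induction b using Quotient.inductionOn
      exact Quotient.sound (BinaryTree.SwapEquiv.swap (.refl _) (.refl _))⟩

@[simp] theorem size_nil : nil.size = 1 := rfl

@[simp] theorem height_nil : nil.height = 0 := rfl

@[simp] theorem size_node (a b : NonplaneTree) : (node s(a, b)).size = a.size + b.size := by
  induction a using Quotient.inductionOn
  induction b using Quotient.inductionOn
  rfl

@[simp] theorem height_node (a b : NonplaneTree) :
    (node s(a, b)).height = max a.height b.height + 1 := by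
  induction a using Quotient.inductionOn
  induction b using Quotient.inductionOn
  rfl

theorem node_injective : Function.Injective node := by
  intro p q
  induction p using Sym2.inductionOn with | _ a b => ?_
  induction q using Sym2.inductionOn with | _ c d => ?_
  induction a using Quotient.inductionOn
  induction b using Quotient.inductionOn
  induction c using Quotient.inductionOn
  induction d using Quotient.inductionOn
  intro h
  rcases Quotient.exact h with _ | ⟨h₁, h₂⟩ | ⟨h₁, h₂⟩
  · rw [Quotient.sound (s := binaryTreeSetoid) h₁, Quotient.sound (s := binaryTreeSetoid) h₂]
  · rw [Quotient.sound (s := binaryTreeSetoid) h₁, Quotient.sound (s := binaryTreeSetoid) h₂]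
    exact Sym2.eq_swap

theorem node_ne_nil (p : Sym2 NonplaneTree) : node p ≠ nil := by
  induction p using Sym2.inductionOn with | _ a b => ?_
  intro h
  simpa using congrArg height h

theorem eq_nil_or_node (t : NonplaneTree) : t = nil ∨ ∃ p, t = node p := by
  induction t using Quotient.inductionOn with | _ t => ?_
  cases t with
  | nil => exact .inl rfl
  | node _ l r => exact .inr ⟨s(Quotient.mk _ l, Quotient.mk _ r), rfl⟩

/-- A tree is an external node or an unordered pair of trees. -/
noncomputable def sumEquiv : Unit ⊕ Sym2 NonplaneTree ≃ NonplaneTree :=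
  Equiv.ofBijective (Sum.elim (fun _ => nil) node) <| by
    constructor
    · rintro (_ | p) (_ | q) h
      · rfl
      · exact absurd h.symm (node_ne_nil q)
      · exact absurd h (node_ne_nil p)
      · exact congrArg Sum.inr (node_injective h)
    · intro t
      rcases eq_nil_or_node t with rfl | ⟨p, rfl⟩
      · exact ⟨.inl (), rfl⟩
      · exact ⟨.inr p, rfl⟩

theorem tsum_eq_nil_add_node (W : NonplaneTree → ℝ≥0∞) :
    ∑' t, W t = W nil + ∑' p, W (node p) := by
  rw [← sumEquiv.tsum_eq, ENNReal.summable.tsum_sum ENNReal.summable]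
  rw [tsum_fintype (L := .unconditional _)]
  simp only [Finset.univ_unique, Finset.sum_singleton]
  rfl

theorem two_mul_tsum (W : NonplaneTree → ℝ≥0∞) :
    2 * ∑' t, W t = 2 * W nil +
      (∑' p : NonplaneTree × NonplaneTree, W (node s(p.1, p.2)) + ∑' t, W (node s(t, t))) := by
  rw [tsum_eq_nil_add_node, mul_add, Sym2.two_mul_tsum]

theorem height_lt_size (t : NonplaneTree) : t.height < t.size := by
  induction t using Quotient.inductionOn with | _ t => ?_
  change t.height < t.numLeaves
  induction t with
  | nil => simp
  | node _ l r hl hr => simp only [BinaryTree.height, BinaryTree.numLeaves]; omega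

/-- The generating function of the trees of height less than `h`. -/
noncomputable def gfLt (h : ℕ) (r : ℝ≥0∞) : ℝ≥0∞ :=
  ∑' t : NonplaneTree, if t.height < h then r ^ t.size else 0

/-- The generating function of the trees of height at least `h`. -/
noncomputable def gfGe (h : ℕ) (r : ℝ≥0∞) : ℝ≥0∞ :=
  ∑' t : NonplaneTree, if h ≤ t.height then r ^ t.size else 0

/-- The generating function of all trees. -/
noncomputable def gf (r : ℝ≥0∞) : ℝ≥0∞ := ∑' t : NonplaneTree, r ^ t.size

theorem gfLt_add_gfGe (h : ℕ) (r : ℝ≥0∞) : gfLt h r + gfGe h r = gf r := by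
  rw [gfLt, gfGe, ← ENNReal.tsum_add]
  refine tsum_congr fun t => ?_
  by_cases ht : t.height < h
  · simp [ht, not_le.2 ht]
  · simp [ht, not_lt.1 ht]

theorem gfLt_zero (r : ℝ≥0∞) : gfLt 0 r = 0 := by simp [gfLt]

theorem gfGe_zero (r : ℝ≥0∞) : gfGe 0 r = gf r := by simp [gfGe, gf]

theorem gfLt_le_gf (h : ℕ) (r : ℝ≥0∞) : gfLt h r ≤ gf r :=
  (gfLt_add_gfGe h r).symm ▸ le_self_add

theorem two_mul_gf (r : ℝ≥0∞) : 2 * gf r = 2 * r + (gf r ^ 2 + gf (r ^ 2)) := by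
  rw [gf, two_mul_tsum]
  simp only [size_nil, pow_one, size_node, pow_add]
  congr 2
  · rw [ENNReal.tsum_prod', sq, ← ENNReal.tsum_mul_right]
    simp_rw [ENNReal.tsum_mul_left]
  · rw [gf]
    exact tsum_congr fun t => by rw [← pow_add, ← two_mul, pow_mul]

theorem two_mul_gfLt_succ (h : ℕ) (r : ℝ≥0∞) :
    2 * gfLt (h + 1) r = 2 * r + (gfLt h r ^ 2 + gfLt h (r ^ 2)) := by
  rw [gfLt, two_mul_tsum]
  simp only [size_nil, pow_one, size_node, pow_add, height_nil, height_node, Nat.succ_pos, if_true,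
    add_lt_add_iff_right, max_lt_iff]
  congr 2
  · rw [ENNReal.tsum_prod', gfLt, sq, ← ENNReal.tsum_mul_right]
    simp_rw [← ENNReal.tsum_mul_left]
    refine tsum_congr fun a => tsum_congr fun b => ?_
    by_cases ha : a.height < h <;> by_cases hb : b.height < h <;> simp [ha, hb]
  · rw [gfLt]
    exact tsum_congr fun t => by simp only [← pow_add, ← two_mul, pow_mul, and_self]

/-- A finite set of trees has bounded height, so convergence can be proved by induction on the
height. -/
theorem gf_le_of_forall_gfLt_le {r C : ℝ≥0∞} (hC : ∀ h, gfLt h r ≤ C) : gf r ≤ C := by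
  rw [gf, ENNReal.tsum_eq_iSup_sum]
  refine iSup_le fun s => ?_
  refine le_trans ?_ (hC (s.sup height + 1))
  refine le_trans (Finset.sum_le_sum fun t ht => ?_) (ENNReal.sum_le_tsum s)
  rw [if_pos (Nat.lt_succ_of_le (Finset.le_sup ht))]

theorem gfLt_mono (h : ℕ) {r s : ℝ≥0∞} (hrs : r ≤ s) : gfLt h r ≤ gfLt h s :=
  ENNReal.tsum_le_tsum fun _ => by split_ifs <;> gcongr

/-- Height at least `h` forces size at least `h + 1`, so one of the two factors `r ^ size` is at
most `r ^ (h + 1)`. -/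
theorem gfGe_sq_le (h : ℕ) {r : ℝ≥0∞} (hr : r ≤ 1) : gfGe h (r ^ 2) ≤ r ^ (h + 1) * gfGe h r := by
  rw [gfGe, gfGe, ← ENNReal.tsum_mul_left]
  refine ENNReal.tsum_le_tsum fun t => ?_
  split_ifs with ht
  · rw [← pow_mul, two_mul, pow_add]
    gcongr ?_ * _
    exact pow_le_pow_right_of_le_one' hr (by have := height_lt_size t; omega)
  · simp

theorem ofSize_eq_preimage (n : ℕ) : ofSize n = size ⁻¹' {n} := rfl

theorem encard_ofSize (n : ℕ) : (ofSize n).encard = count n :=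
  ((finite_ofSize n).cast_ncard_eq).symm

theorem gf_eq_tsum_count (r : ℝ≥0∞) : gf r = ∑' n, (count n : ℝ≥0∞) * r ^ n := by
  rw [gf, ENNReal.tsum_eq_tsum_encard_mul size fun n => r ^ n]
  refine tsum_congr fun n => ?_
  rw [← ofSize_eq_preimage, encard_ofSize]
  simp

/-- The bound 1 reproduces itself under the height recursion. This criterion for convergence at `r`
needs information only at `r ^ 2`. -/
theorem gf_le_one {r : ℝ≥0∞} (hr : 2 * r + gf (r ^ 2) ≤ 1) : gf r ≤ 1 := by
  refine gf_le_of_forall_gfLt_le fun h => ?_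
  induction h with
  | zero => simp [gfLt_zero]
  | succ h ih =>
    have : 2 * gfLt (h + 1) r ≤ 2 * 1 := by
      rw [two_mul_gfLt_succ]
      calc 2 * r + (gfLt h r ^ 2 + gfLt h (r ^ 2)) ≤ 2 * r + (1 ^ 2 + gf (r ^ 2)) := by
            gcongr; exact gfLt_le_gf _ _
        _ = (2 * r + gf (r ^ 2)) + 1 := by ring
        _ ≤ 1 + 1 := by gcongr
        _ = 2 * 1 := by norm_num
    exact (ENNReal.mul_le_mul_iff_right (by simp) (by simp)).1 this

/-- The bound `1/2` is stable because `2/8 + (1/2)^2 + 1/2 = 1`. This gives a positive radius of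
convergence. -/
theorem gf_eighth_le : gf (1 / 8) ≤ 1 := by
  have h8 : (1 / 8 : ℝ≥0∞) = ENNReal.ofReal (1 / 8) := by
    rw [ENNReal.ofReal_div_of_pos (by norm_num)]; simp
  have key : ∀ h, gfLt h (1 / 8) ≤ ENNReal.ofReal (1 / 2) := by
    intro h
    induction h with
    | zero => simp [gfLt_zero]
    | succ h ih =>
      have : 2 * gfLt (h + 1) (1 / 8) ≤ 2 * ENNReal.ofReal (1 / 2) := by
        rw [two_mul_gfLt_succ]
        calc 2 * (1 / 8) + (gfLt h (1 / 8) ^ 2 + gfLt h ((1 / 8) ^ 2))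
            ≤ 2 * (1 / 8) + (ENNReal.ofReal (1 / 2) ^ 2 + ENNReal.ofReal (1 / 2)) := by
              gcongr
              refine (gfLt_mono h ?_).trans ih
              exact pow_le_of_le_one zero_le (by rw [h8]; exact ENNReal.ofReal_le_one.2 (by norm_num))
                two_ne_zero
          _ = 2 * ENNReal.ofReal (1 / 2) := by
              rw [h8, ← ENNReal.ofReal_pow (by norm_num), ← ENNReal.ofReal_ofNat 2,
                ← ENNReal.ofReal_mul (by norm_num), ← ENNReal.ofReal_mul (by norm_num),
                ← ENNReal.ofReal_add (by norm_num) (by norm_num),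
                ← ENNReal.ofReal_add (by norm_num) (by norm_num)]
              norm_num
      exact (ENNReal.mul_le_mul_iff_right (by simp) (by simp)).1 this
  exact gf_le_of_forall_gfLt_le fun h => (key h).trans (ENNReal.ofReal_le_one.2 (by norm_num))

theorem count_zero : count 0 = 0 := by
  rw [count, Set.ncard_eq_zero (finite_ofSize 0)]
  refine Set.eq_empty_of_forall_notMem fun t ht => ?_
  have := height_lt_size t
  have h : t.size = 0 := ht
  omega

theorem two_mul_count (n : ℕ) :
    2 * count n = 2 * (if n = 1 then 1 else 0) +
      (∑ p ∈ Finset.HasAntidiagonal.antidiagonal n, count p.1 * count p.2 +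
        if Even n then count (n / 2) else 0) := by
  have hc : ∀ m : ℕ, ∑' t : NonplaneTree, (if t.size = m then 1 else 0 : ℝ≥0∞) = count m := by
    intro m
    rw [ENNReal.tsum_eq_tsum_encard_mul size fun k => if k = m then 1 else 0]
    rw [tsum_eq_single m fun k hk => by simp [hk], ← ofSize_eq_preimage, encard_ofSize]
    simp
  have h := two_mul_tsum fun t => if t.size = n then (1 : ℝ≥0∞) else 0
  rw [hc] at h
  simp only [size_nil, size_node] at h
  have h₁ : ∑' p : NonplaneTree × NonplaneTree,
      (if p.1.size + p.2.size = n then 1 else 0 : ℝ≥0∞) =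
      ∑ p ∈ Finset.HasAntidiagonal.antidiagonal n, (count p.1 * count p.2 : ℝ≥0∞) := by
    have : ∀ p : NonplaneTree × NonplaneTree,
        (if p.1.size + p.2.size = n then 1 else 0 : ℝ≥0∞) =
        ∑ q ∈ Finset.HasAntidiagonal.antidiagonal n,
          (if p.1.size = q.1 then 1 else 0) * (if p.2.size = q.2 then 1 else 0) := by
      intro p
      split_ifs with hp
      · rw [Finset.sum_eq_single (p.1.size, p.2.size)]
        · simp
        · rintro ⟨a, b⟩ _ hab
          by_cases h1 : p.1.size = a
          · by_cases h2 : p.2.size = b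
            · simp [h1, h2] at hab
            · simp [h2]
          · simp [h1]
        · simp [hp]
      · refine (Finset.sum_eq_zero ?_).symm
        rintro ⟨a, b⟩ hab
        rw [Finset.HasAntidiagonal.mem_antidiagonal] at hab
        by_cases h1 : p.1.size = a
        · by_cases h2 : p.2.size = b
          · exact absurd (by simpa [h1, h2] using hab) hp
          · simp [h2]
        · simp [h1]
    simp_rw [this]
    rw [Summable.tsum_finsetSum fun _ _ => ENNReal.summable]
    refine Finset.sum_congr rfl fun q _ => ?_
    rw [ENNReal.tsum_prod']
    have h₃ : ∀ a : NonplaneTree, ∑' b : NonplaneTree,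
        (if a.size = q.1 then 1 else 0 : ℝ≥0∞) * (if b.size = q.2 then 1 else 0) =
        (if a.size = q.1 then 1 else 0) * (count q.2 : ℝ≥0∞) :=
      fun a => by rw [ENNReal.tsum_mul_left, hc]
    refine (tsum_congr h₃).trans ?_
    rw [ENNReal.tsum_mul_right, hc]
  have h₂ : ∑' t : NonplaneTree, (if t.size + t.size = n then 1 else 0 : ℝ≥0∞) =
      if Even n then (count (n / 2) : ℝ≥0∞) else 0 := by
    split_ifs with hn
    · rw [← hc]
      obtain ⟨k, rfl⟩ := hn
      refine tsum_congr fun t => ?_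
      congr 1
      rw [eq_iff_iff]
      omega
    · rw [ENNReal.tsum_eq_zero]
      intro t
      rw [if_neg]
      rintro rfl
      exact hn ⟨_, rfl⟩
  rw [h₁, h₂] at h
  have h3 : (1 = n) ↔ (n = 1) := eq_comm
  simp only [h3] at h
  rw [← Nat.cast_inj (R := ℝ≥0∞)]
  push_cast
  exact h

end NonplaneTree

/-! ### Termwise differentiation of series with nonnegative coefficients -/

theorem summable_nat_mul_of_lt {a : ℕ → ℝ} (ha : ∀ n, 0 ≤ a n) {r s : ℝ} (hr : 0 ≤ r) (hrs : r < s)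
    (hs : Summable fun n => a n * s ^ n) : Summable fun n : ℕ => (n : ℝ) * (a n * r ^ n) := by
  have hs0 : 0 < s := hr.trans_lt hrs
  have h1 : |r / s| < 1 := by
    rw [abs_of_nonneg (by positivity)]
    exact (div_lt_one hs0).2 hrs
  obtain ⟨C, hC⟩ := (tendsto_self_mul_const_pow_of_abs_lt_one h1).bddAbove_range
  refine Summable.of_nonneg_of_le (fun n => by have := ha n; positivity) (fun n => ?_)
    (hs.mul_left C)
  have h2 : (n : ℝ) * (r / s) ^ n ≤ C := hC ⟨n, rfl⟩
  calc (n : ℝ) * (a n * r ^ n) = ((n : ℝ) * (r / s) ^ n) * (a n * s ^ n) := by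
        rw [div_pow]; field_simp
    _ ≤ C * (a n * s ^ n) := by
        have := ha n
        gcongr

theorem hasDerivAt_tsum_mul_pow {a : ℕ → ℝ} (ha : ∀ n, 0 ≤ a n) {r s : ℝ} (hr : 0 < r)
    (hrs : r < s) (hs : Summable fun n => a n * s ^ n) :
    HasDerivAt (fun z => ∑' n, a n * z ^ n) (∑' n : ℕ, a n * (n * r ^ (n - 1))) r := by
  obtain ⟨t, hrt, hts⟩ := exists_between hrs
  have ht : 0 < t := hr.trans hrt
  have hsum := summable_nat_mul_of_lt ha ht.le hts hs
  refine hasDerivAt_tsum_of_isPreconnected (u := fun n : ℕ => t⁻¹ * ((n : ℝ) * (a n * t ^ n)))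
    (t := Set.Ioo 0 t) (g := fun n z => a n * z ^ n) (g' := fun n z => a n * (n * z ^ (n - 1)))
    (hsum.mul_left _) isOpen_Ioo isPreconnected_Ioo (fun n y _ => ?_) (fun n y hy => ?_)
    (y₀ := r) ⟨hr, hrt⟩ ?_ ⟨hr, hrt⟩
  · exact (hasDerivAt_pow n y).const_mul _
  · have := ha n
    have := hy.1
    rw [Real.norm_of_nonneg (by positivity)]
    rcases n with _ | n
    · simp
    · have : y ^ n ≤ t ^ n := by gcongr; exact hy.2.le
      calc a (n + 1) * (((n + 1 : ℕ) : ℝ) * y ^ (n + 1 - 1))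
          ≤ a (n + 1) * (((n + 1 : ℕ) : ℝ) * t ^ n) := by
            simp only [Nat.add_sub_cancel]; gcongr
        _ = _ := by rw [pow_succ]; field_simp
  · refine Summable.of_nonneg_of_le (fun n => by have := ha n; positivity) (fun n => ?_) hs
    have := ha n
    gcongr

/-! ### The real generating function and its value at the singularity -/

namespace NonplaneTree

theorem gf_coe (r : ℝ≥0) : gf r = ∑' n, (((count n : ℝ≥0) * r ^ n : ℝ≥0) : ℝ≥0∞) := by
  rw [gf_eq_tsum_count]
  simp

theorem gf_ne_top_iff (r : ℝ≥0) : gf r ≠ ⊤ ↔ Summable fun n => (count n : ℝ) * (r : ℝ) ^ n := by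
  rw [gf_coe, ENNReal.tsum_coe_ne_top_iff_summable, ← NNReal.summable_coe]
  simp

theorem gf_ofReal_ne_top_iff {r : ℝ} (hr : 0 ≤ r) :
    gf (ENNReal.ofReal r) ≠ ⊤ ↔ Summable fun n => (count n : ℝ) * r ^ n := by
  lift r to ℝ≥0 using hr
  rw [ENNReal.ofReal_coe_nnreal, gf_ne_top_iff]

theorem gf_ofReal {r : ℝ} (hr : 0 ≤ r) (h : Summable fun n => (count n : ℝ) * r ^ n) :
    gf (ENNReal.ofReal r) = ENNReal.ofReal (genFun r) := by
  rw [genFun, ENNReal.ofReal_tsum_of_nonneg (fun n => by positivity) h, gf_eq_tsum_count]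
  refine tsum_congr fun n => ?_
  rw [ENNReal.ofReal_mul (by positivity), ENNReal.ofReal_pow hr, ENNReal.ofReal_natCast]

theorem genFun_nonneg {r : ℝ} (hr : 0 ≤ r) : 0 ≤ genFun r :=
  tsum_nonneg fun n => by positivity

theorem sq_le_self {r : ℝ} (hr : 0 ≤ r) (hr1 : r ≤ 1) : r ^ 2 ≤ r :=
  pow_le_of_le_one hr hr1 two_ne_zero

theorem summable_of_le {r s : ℝ} (hr : 0 ≤ r) (hrs : r ≤ s)
    (h : Summable fun n => (count n : ℝ) * s ^ n) : Summable fun n => (count n : ℝ) * r ^ n :=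
  Summable.of_nonneg_of_le (fun n => by positivity) (fun n => by gcongr) h

theorem genFun_sq_eq_of_sq {r : ℝ} (hr : 0 ≤ r) (h : Summable fun n => (count n : ℝ) * r ^ n)
    (h2 : Summable fun n => (count n : ℝ) * (r ^ 2) ^ n) :
    (1 - genFun r) ^ 2 = 1 - 2 * r - genFun (r ^ 2) := by
  have key := two_mul_gf (ENNReal.ofReal r)
  have := genFun_nonneg hr
  have := genFun_nonneg (sq_nonneg r)
  rw [← ENNReal.ofReal_pow hr, gf_ofReal hr h, gf_ofReal (by positivity) h2,
    ← ENNReal.ofReal_pow (genFun_nonneg hr), ← ENNReal.ofReal_ofNat 2,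
    ← ENNReal.ofReal_mul (by norm_num), ← ENNReal.ofReal_mul (by norm_num),
    ← ENNReal.ofReal_add (by positivity) (by positivity),
    ← ENNReal.ofReal_add (by positivity) (by positivity),
    ENNReal.ofReal_eq_ofReal_iff (by positivity) (by positivity)] at key
  linarith

theorem le_half_of_summable {r : ℝ} (h : Summable fun n => (count n : ℝ) * r ^ n) :
    r ≤ 1 / 2 := by
  by_contra! hlt
  have hr : 0 ≤ r := by linarith
  -- Truncating at 1 ensures that the square is no larger, so the series also converges there.
  have h' := summable_of_le (r := min r 1) (by positivity) (min_le_left _ _) h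
  have h2 := summable_of_le (by positivity) (sq_le_self (r := min r 1) (by positivity)
    (min_le_right _ _)) h'
  have key := genFun_sq_eq_of_sq (by positivity) h' h2
  have := genFun_nonneg (sq_nonneg (min r 1))
  have : 1 / 2 < min r 1 := lt_min hlt (by norm_num)
  nlinarith [sq_nonneg (1 - genFun (min r 1))]

theorem genFun_sq_eq {r : ℝ} (hr : 0 ≤ r) (h : Summable fun n => (count n : ℝ) * r ^ n) :
    (1 - genFun r) ^ 2 = 1 - 2 * r - genFun (r ^ 2) :=
  genFun_sq_eq_of_sq hr h <| summable_of_le (by positivity)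
    (sq_le_self hr ((le_half_of_summable h).trans (by norm_num))) h

theorem summable_of_lt_radius {r : ℝ≥0}
    (hr : r < (FormalMultilinearSeries.ofScalars ℝ (fun n => (count n : ℝ))).radius) :
    Summable fun n => (count n : ℝ) * (r : ℝ) ^ n := by
  have := FormalMultilinearSeries.summable_norm_mul_pow _ hr
  simpa [FormalMultilinearSeries.ofScalars_norm] using this

theorem le_radius_of_summable {r : ℝ≥0} (h : Summable fun n => (count n : ℝ) * (r : ℝ) ^ n) :
    r ≤ (FormalMultilinearSeries.ofScalars ℝ (fun n => (count n : ℝ))).radius := by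
  refine FormalMultilinearSeries.le_radius_of_summable _ ?_
  simpa [FormalMultilinearSeries.ofScalars_norm] using h

theorem radius_ne_top :
    (FormalMultilinearSeries.ofScalars ℝ (fun n => (count n : ℝ))).radius ≠ ⊤ := by
  intro h
  have := le_half_of_summable (r := ((1 : ℝ≥0) : ℝ))
    (summable_of_lt_radius (by rw [h]; simp))
  norm_num at this

theorem coe_lt_radius_iff {r : ℝ} (hr : 0 ≤ r) : ENNReal.ofReal r <
    (FormalMultilinearSeries.ofScalars ℝ (fun n => (count n : ℝ))).radius ↔ r < rho := by
  rw [rho, ENNReal.ofReal_lt_iff_lt_toReal hr radius_ne_top]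

theorem summable_of_lt_rho {r : ℝ} (hr : 0 ≤ r) (h : r < rho) :
    Summable fun n => (count n : ℝ) * r ^ n := by
  have := (coe_lt_radius_iff hr).2 h
  lift r to ℝ≥0 using hr
  rw [ENNReal.ofReal_coe_nnreal] at this
  exact summable_of_lt_radius this

theorem le_rho_of_summable {r : ℝ} (hr : 0 ≤ r) (h : Summable fun n => (count n : ℝ) * r ^ n) :
    r ≤ rho := by
  by_contra! hlt
  have h0 : 0 ≤ rho := ENNReal.toReal_nonneg
  lift r to ℝ≥0 using hr
  have h1 := le_radius_of_summable h
  rw [← ENNReal.ofReal_toReal radius_ne_top, ← rho] at h1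
  rw [← ENNReal.ofReal_coe_nnreal, ENNReal.ofReal_le_ofReal_iff h0] at h1
  linarith

theorem rho_pos : 0 < rho := by
  have h : Summable fun n => (count n : ℝ) * (1 / 8 : ℝ) ^ n := by
    rw [← gf_ofReal_ne_top_iff (by norm_num)]
    have h8 : (1 / 8 : ℝ≥0∞) = ENNReal.ofReal (1 / 8) := by
      rw [ENNReal.ofReal_div_of_pos (by norm_num)]; simp
    rw [← h8]
    exact ne_top_of_le_ne_top ENNReal.one_ne_top gf_eighth_le
  linarith [le_rho_of_summable (by norm_num) h]

theorem rho_le_half : rho ≤ 1 / 2 := by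
  by_contra! hlt
  obtain ⟨r, h1, h2⟩ := exists_between hlt
  have := le_half_of_summable (summable_of_lt_rho (by linarith) h2)
  linarith

theorem rho_sq_lt : rho ^ 2 < rho := by nlinarith [rho_pos, rho_le_half]

theorem hasDerivAt_genFun {r : ℝ} (hr : 0 < r) (h : r < rho) :
    HasDerivAt genFun (∑' n : ℕ, (count n : ℝ) * (n * r ^ (n - 1))) r := by
  obtain ⟨s, h1, h2⟩ := exists_between h
  exact hasDerivAt_tsum_mul_pow (fun n => by positivity) hr h1
    (summable_of_lt_rho (hr.trans h1).le h2)

theorem hasFPowerSeriesOnBall_genFun : HasFPowerSeriesOnBall genFun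
    (FormalMultilinearSeries.ofScalars ℝ (fun n => (count n : ℝ))) 0
    (FormalMultilinearSeries.ofScalars ℝ (fun n => (count n : ℝ))).radius := by
  have h0 : 0 < (FormalMultilinearSeries.ofScalars ℝ (fun n => (count n : ℝ))).radius :=
    lt_of_le_of_lt bot_le ((coe_lt_radius_iff le_rfl).2 rho_pos)
  convert FormalMultilinearSeries.hasFPowerSeriesOnBall _ h0 using 1
  funext z
  simp [genFun, FormalMultilinearSeries.sum, mul_comm]

theorem analyticAt_genFun {r : ℝ} (hr : 0 ≤ r) (h : r < rho) : AnalyticAt ℝ genFun r := by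
  refine hasFPowerSeriesOnBall_genFun.analyticAt_of_mem ?_
  have := (coe_lt_radius_iff hr).2 h
  simpa [edist_dist, abs_of_nonneg hr] using this

theorem count_one : count 1 = 1 := by
  have := two_mul_count 1
  simp [Finset.Nat.antidiagonal_succ, count_zero] at this
  omega

theorem count_two : count 2 = 1 := by
  have := two_mul_count 2
  simp [Finset.Nat.antidiagonal_succ, count_zero, count_one] at this
  omega

theorem genFun_zero : genFun 0 = 0 := by
  rw [genFun, tsum_eq_single 0]
  · simp [count_zero]
  · intro n hn
    simp [hn]

theorem le_genFun {r : ℝ} (hr : 0 ≤ r) (h : r < rho) : r ≤ genFun r := by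
  have := (summable_of_lt_rho hr h).le_tsum 1 fun n _ => by positivity
  simpa [count_one, genFun] using this

theorem genFun_mono {r s : ℝ} (hr : 0 ≤ r) (hrs : r ≤ s) (h : s < rho) : genFun r ≤ genFun s :=
  (summable_of_lt_rho hr (hrs.trans_lt h)).tsum_le_tsum (fun n => by gcongr)
    (summable_of_lt_rho (hr.trans hrs) h)

theorem sq_lt_rho {r : ℝ} (hr : 0 ≤ r) (h : r < rho) : r ^ 2 < rho := by
  nlinarith [rho_le_half]

theorem continuousOn_genFun : ContinuousOn genFun (Set.Ico 0 rho) := fun _ hr =>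
  (analyticAt_genFun hr.1 hr.2).continuousAt.continuousWithinAt

/-- If `y(r) = 1` then `2 r + y(r^2) = 1`; at a larger `s < rho` this sum exceeds 1, making `(1 -
y(s))^2` negative. -/
theorem genFun_ne_one {r : ℝ} (hr : 0 ≤ r) (h : r < rho) : genFun r ≠ 1 := by
  intro h1
  obtain ⟨s, hrs, hs⟩ := exists_between h
  have e1 := genFun_sq_eq hr (summable_of_lt_rho hr h)
  have e2 := genFun_sq_eq (hr.trans hrs.le) (summable_of_lt_rho (hr.trans hrs.le) hs)
  have := genFun_mono (sq_nonneg r) (pow_le_pow_left₀ hr hrs.le 2) (sq_lt_rho (hr.trans hrs.le) hs)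
  rw [h1] at e1
  nlinarith [sq_nonneg (1 - genFun s)]

theorem genFun_lt_one {r : ℝ} (hr : 0 ≤ r) (h : r < rho) : genFun r < 1 := by
  by_contra! hge
  have hsub : Set.Icc 0 r ⊆ Set.Ico 0 rho := fun x hx => ⟨hx.1, hx.2.trans_lt h⟩
  obtain ⟨x, hx, hx1⟩ := intermediate_value_Icc hr (continuousOn_genFun.mono hsub)
    (show (1 : ℝ) ∈ Set.Icc (genFun 0) (genFun r) from ⟨by rw [genFun_zero]; norm_num, hge⟩)
  exact genFun_ne_one hx.1 (hsub hx).2 hx1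

/-- A square is nonnegative, which gives `≤` in the limit from the left. If the inequality were
strict it would persist just beyond `rho`, where `gf_le_one` would yield convergence. -/
theorem two_mul_rho_add_genFun : 2 * rho + genFun (rho ^ 2) = 1 := by
  have hcont : ContinuousAt (fun r => 2 * r + genFun (r ^ 2)) rho := by
    have h1 : ContinuousAt genFun (rho ^ 2) :=
      (analyticAt_genFun (sq_nonneg _) rho_sq_lt).continuousAt
    have h2 : ContinuousAt (fun r => genFun (r ^ 2)) rho :=
      ContinuousAt.comp' (f := fun r : ℝ => r ^ 2) h1 (by fun_prop)
    fun_prop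
  refine le_antisymm ?_ ?_
  · refine le_of_tendsto (hcont.tendsto.mono_left (nhdsWithin_le_nhds (s := Set.Iio rho))) ?_
    filter_upwards [Ioo_mem_nhdsLT rho_pos] with r hr
    have := genFun_sq_eq hr.1.le (summable_of_lt_rho hr.1.le hr.2)
    nlinarith [sq_nonneg (1 - genFun r)]
  · by_contra! hlt
    have h1 : ∀ᶠ r in 𝓝[>] rho, 2 * r + genFun (r ^ 2) < 1 :=
      (hcont.tendsto.mono_left nhdsWithin_le_nhds).eventually_lt_const hlt
    have h2 : ∀ᶠ r in 𝓝[>] rho, r ^ 2 < rho :=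
      (((continuous_pow 2).tendsto rho).mono_left nhdsWithin_le_nhds).eventually_lt_const rho_sq_lt
    obtain ⟨r, h1, h2, h3⟩ := (h1.and (h2.and self_mem_nhdsWithin)).exists
    have hr0 : 0 ≤ r := rho_pos.le.trans (le_of_lt h3)
    have hle : gf (ENNReal.ofReal r) ≤ 1 := by
      refine gf_le_one ?_
      rw [← ENNReal.ofReal_pow hr0, gf_ofReal (by positivity)
        (summable_of_lt_rho (by positivity) h2), ← ENNReal.ofReal_ofNat 2,
        ← ENNReal.ofReal_mul (by norm_num),
        ← ENNReal.ofReal_add (by positivity) (genFun_nonneg (sq_nonneg r))]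
      exact ENNReal.ofReal_le_one.2 h1.le
    have := le_rho_of_summable hr0
      ((gf_ofReal_ne_top_iff hr0).1 (ne_top_of_le_ne_top ENNReal.one_ne_top hle))
    exact absurd this (not_le.2 h3)

/-! ### Generating functions of tall trees -/

/-- The trees of height at least `h` have a generating function of order `y(r) ^ (h + 1)`. -/
theorem gfGe_le {r : ℝ} (hr : 0 ≤ r) (h : r < rho) (k : ℕ) :
    gfGe k (ENNReal.ofReal r) ≤
      ENNReal.ofReal (genFun r ^ (k + 1) * Real.exp (∑ i ∈ Finset.range k, r ^ i / 2)) := by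
  have hs := summable_of_lt_rho hr h
  have hr1 : ENNReal.ofReal r ≤ 1 := ENNReal.ofReal_le_one.2 (by linarith [rho_le_half])
  have hg := gf_ofReal hr hs
  have hy := genFun_nonneg hr
  induction k with
  | zero => simp [gfGe_zero, hg]
  | succ k ih =>
    have hfin : ∀ k, gfLt k (ENNReal.ofReal r) ≠ ⊤ := fun k =>
      ne_top_of_le_ne_top (by rw [hg]; exact ENNReal.ofReal_ne_top) (gfLt_le_gf _ _)
    -- Subtracting the recursion for bounded height from the functional equation, and discarding a
    -- term `-gfGe k x ^ 2`. Subtraction is replaced by cancelling a finite summand.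
    have hrec : 2 * gfGe (k + 1) (ENNReal.ofReal r) ≤
        2 * (gfGe k (ENNReal.ofReal r) * gf (ENNReal.ofReal r)) +
          gfGe k (ENNReal.ofReal r ^ 2) := by
      set x := ENNReal.ofReal r
      have e1 := two_mul_gf x
      have e2 := two_mul_gfLt_succ k x
      rw [← gfLt_add_gfGe (k + 1) x, mul_add, e2, ← gfLt_add_gfGe k (x ^ 2)] at e1
      have hx2 : gfLt k (x ^ 2) ≠ ⊤ := ne_top_of_le_ne_top (hfin k) <|
        gfLt_mono k (pow_le_of_le_one zero_le hr1 two_ne_zero)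
      have hne : 2 * x + (gfLt k x ^ 2 + gfLt k (x ^ 2)) ≠ ⊤ := by
        have := hfin k
        finiteness
      have e3 : (2 * x + (gfLt k x ^ 2 + gfLt k (x ^ 2))) + 2 * gfGe (k + 1) x ≤
          (2 * x + (gfLt k x ^ 2 + gfLt k (x ^ 2))) +
          (2 * (gfGe k x * gf x) + gfGe k (x ^ 2)) := by
        rw [e1, gfLt_add_gfGe (k + 1) x]
        rw [← gfLt_add_gfGe k x]
        calc _ ≤ 2 * x + ((gfLt k x + gfGe k x) ^ 2 + (gfLt k (x ^ 2) + gfGe k (x ^ 2))) +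
              gfGe k x ^ 2 := le_self_add
          _ = _ := by ring
      exact (ENNReal.add_le_add_iff_left hne).1 e3
    have hsq := gfGe_sq_le k hr1
    have hle : 2 * gfGe (k + 1) (ENNReal.ofReal r) ≤
        gfGe k (ENNReal.ofReal r) * ENNReal.ofReal (2 * (genFun r * Real.exp (r ^ k / 2))) := by
      -- Since `r ≤ y(r)`, the left side is at most `2 y(r) (1 + r^k / 2)`, and `1 + u ≤ exp u`.
      have hnum : ENNReal.ofReal (2 * genFun r + r ^ (k + 1)) ≤
          ENNReal.ofReal (2 * (genFun r * Real.exp (r ^ k / 2))) := by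
        refine ENNReal.ofReal_le_ofReal ?_
        have e1 := Real.add_one_le_exp (r ^ k / 2)
        have e2 := mul_le_mul_of_nonneg_left e1 hy
        have e3 := mul_le_mul_of_nonneg_right (le_genFun hr h) (pow_nonneg hr k)
        rw [pow_succ]
        nlinarith
      refine hrec.trans (le_trans ?_ (mul_le_mul_right hnum _))
      rw [ENNReal.ofReal_add (by positivity) (by positivity), ENNReal.ofReal_mul (by norm_num),
        ENNReal.ofReal_pow hr, ENNReal.ofReal_ofNat, ← hg]
      calc _ ≤ 2 * (gfGe k (ENNReal.ofReal r) * gf (ENNReal.ofReal r)) +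
            ENNReal.ofReal r ^ (k + 1) * gfGe k (ENNReal.ofReal r) := by gcongr
        _ = _ := by ring
    have hle2 : 2 * gfGe (k + 1) (ENNReal.ofReal r) ≤
        2 * ENNReal.ofReal (genFun r ^ (k + 1 + 1) *
          Real.exp (∑ i ∈ Finset.range (k + 1), r ^ i / 2)) := by
      refine hle.trans ((mul_le_mul_left ih _).trans (le_of_eq ?_))
      rw [← ENNReal.ofReal_mul (by positivity), ← ENNReal.ofReal_ofNat 2,
        ← ENNReal.ofReal_mul (by norm_num), Finset.sum_range_succ, Real.exp_add]
      congr 1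
      ring
    exact (ENNReal.mul_le_mul_iff_right (by simp) (by simp)).1 hle2

theorem gfGe_le_exp_one {r : ℝ} (hr : 0 ≤ r) (h : r < rho) (k : ℕ) :
    gfGe k (ENNReal.ofReal r) ≤ ENNReal.ofReal (genFun r ^ k * Real.exp 1) := by
  refine (gfGe_le hr h k).trans (ENNReal.ofReal_le_ofReal ?_)
  have hy := genFun_nonneg hr
  have h1 : ∑ i ∈ Finset.range k, r ^ i / 2 ≤ 1 := by
    rw [← Finset.sum_div, div_le_one (by norm_num)]
    calc ∑ i ∈ Finset.range k, r ^ i ≤ ∑ i ∈ Finset.range k, (1 / 2 : ℝ) ^ i := by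
          gcongr
          exact h.le.trans rho_le_half
      _ ≤ 2 := sum_geometric_two_le k
  gcongr ?_ * Real.exp ?_
  exact pow_le_pow_of_le_one hy (genFun_lt_one hr h).le (Nat.le_succ k)

end NonplaneTree

/-! ### Formal substitution and the series of an inverse square root -/

namespace PowerSeries

theorem coeff_pow_eq_zero_of_lt {F : ℝ⟦X⟧} (hF : constantCoeff F = 0) {n k : ℕ} (h : n < k) :
    coeff n (F ^ k) = 0 := by
  have h1 : (X : ℝ⟦X⟧) ^ k ∣ F ^ k := pow_dvd_pow_of_dvd (X_dvd_iff.2 hF) k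
  exact X_pow_dvd_iff.1 h1 n h

theorem coeff_subst_eq_sum {F : ℝ⟦X⟧} (hF : constantCoeff F = 0) (B : ℝ⟦X⟧) (n : ℕ) :
    coeff n (B.subst F) = ∑ k ∈ Finset.range (n + 1), coeff k B * coeff n (F ^ k) := by
  rw [coeff_subst' (HasSubst.of_constantCoeff_zero' hF)]
  rw [finsum_eq_sum_of_support_subset]
  · rfl
  · intro k hk
    by_contra hk'
    simp only [Finset.coe_range, Set.mem_Iio, not_lt] at hk'
    exact hk (by simp [coeff_pow_eq_zero_of_lt hF (show n < k by omega)])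

theorem coeff_pow_nonneg {F : ℝ⟦X⟧} (hF : ∀ n, 0 ≤ coeff n F) (k n : ℕ) :
    0 ≤ coeff n (F ^ k) := by
  induction k generalizing n with
  | zero => rw [pow_zero, coeff_one]; split_ifs <;> norm_num
  | succ k ih =>
    rw [pow_succ, coeff_mul]
    exact Finset.sum_nonneg fun p _ => mul_nonneg (ih _) (hF _)

/-- The power series of `(1 - X) ^ (-1/2)`. -/
noncomputable def invSqrtOneSub : ℝ⟦X⟧ := mk fun k => (k.centralBinom : ℝ) / 4 ^ k

theorem invSqrtOneSub_sq_mul : invSqrtOneSub ^ 2 * (1 - X) = 1 := by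
  -- This differential equation, equivalent to the recursion for central binomials, makes the
  -- derivative of `invSqrtOneSub ^ 2 * (1 - X)` vanish.
  have hrec : 2 * (derivative ℝ invSqrtOneSub * (1 - X)) = invSqrtOneSub := by
    ext n
    have h2 : (2 : ℝ⟦X⟧) = C (2 : ℝ) := (map_ofNat C 2).symm
    rw [h2, coeff_C_mul, mul_sub, mul_one, map_sub]
    rcases n with _ | n
    · simp [coeff_derivative, invSqrtOneSub]
      norm_num [Nat.centralBinom]
    · have h := Nat.succ_mul_centralBinom_succ (n + 1)
      have h' : ((n : ℝ) + 2) * ((n + 1 + 1).centralBinom : ℝ) =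
          2 * (2 * (n + 1) + 1) * ((n + 1).centralBinom : ℝ) := by
        have := congrArg (Nat.cast (R := ℝ)) h
        push_cast at this
        linarith
      rw [coeff_succ_mul_X]
      simp only [coeff_derivative, invSqrtOneSub, coeff_mk]
      push_cast
      rw [pow_succ (4 : ℝ) (n + 1)]
      field_simp
      linarith
  refine derivative.ext ?_ ?_
  · have : derivative ℝ (invSqrtOneSub ^ 2 * (1 - X)) =
        invSqrtOneSub * (2 * (derivative ℝ invSqrtOneSub * (1 - X))) - invSqrtOneSub ^ 2 := by
      rw [Derivation.leibniz, Derivation.leibniz_pow]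
      simp
      ring
    rw [this, hrec]
    simp
    ring
  · simp [invSqrtOneSub]

theorem inv_sqrt_le_coeff (k : ℕ) : 1 / (2 * √((k : ℝ) + 1)) ≤ coeff k invSqrtOneSub := by
  -- The right side equals 1 at `k = 0` and increases, since `(2k+1)^2 (4k+5) = (2k+2)^2 (4k+1) +
  -- 1`.
  have key : 1 ≤ (coeff k invSqrtOneSub) ^ 2 * (4 * k + 1) := by
    induction k with
    | zero => simp [invSqrtOneSub]
    | succ k ih =>
      have h := Nat.succ_mul_centralBinom_succ k
      have h' : ((k : ℝ) + 1) * ((k + 1).centralBinom : ℝ) =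
          2 * (2 * k + 1) * (k.centralBinom : ℝ) := by exact_mod_cast h
      have hb : coeff (k + 1) invSqrtOneSub =
          coeff k invSqrtOneSub * ((2 * k + 1) / (2 * (k + 1))) := by
        simp only [invSqrtOneSub, coeff_mk, pow_succ]
        field_simp
        linarith
      rw [hb, mul_pow]
      refine ih.trans ?_
      rw [mul_assoc]
      gcongr
      rw [div_pow, div_mul_eq_mul_div, le_div_iff₀ (by positivity)]
      push_cast
      nlinarith [(Nat.cast_nonneg k : (0 : ℝ) ≤ k)]
  have hb0 : 0 ≤ coeff k invSqrtOneSub := by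
    simp only [invSqrtOneSub, coeff_mk]; positivity
  refine (sq_le_sq₀ (by positivity) hb0).1 ?_
  rw [div_pow, mul_pow, Real.sq_sqrt (by positivity), div_le_iff₀ (by positivity)]
  nlinarith [sq_nonneg (coeff k invSqrtOneSub)]

end PowerSeries

/-! ### A lower bound for renewal sequences -/

open PowerSeries in
/-- Renewal sequences with finite mean are bounded below. -/
theorem exists_pos_le_renewal {F U : ℝ⟦X⟧} (hFU : (1 - F) * U = 1) (hF0 : constantCoeff F = 0)
    (hF : ∀ n, 0 ≤ coeff n F) (hF1 : 0 < coeff 1 F) (hsum : HasSum (fun n => coeff n F) 1)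
    (hmean : Summable fun n : ℕ => (n : ℝ) * coeff n F) (hU : ∀ n, 0 ≤ coeff n U) :
    ∃ c > 0, ∀ n, c ≤ coeff n U := by
  have hrec : U = 1 + F * U := by linear_combination hFU
  have hUF : ∀ n k, coeff k F * coeff n U ≤ coeff (n + k) U := by
    intro n k
    conv_rhs => rw [hrec]
    rw [map_add, coeff_mul]
    have h1 : 0 ≤ coeff (n + k) (1 : ℝ⟦X⟧) := by rw [coeff_one]; split_ifs <;> norm_num
    have h2 := Finset.single_le_sum
      (f := fun p : ℕ × ℕ => coeff p.1 F * coeff p.2 U) (fun p _ => mul_nonneg (hF _) (hU _))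
      (Finset.HasAntidiagonal.mem_antidiagonal.2 (Nat.add_comm k n) :
        (k, n) ∈ Finset.HasAntidiagonal.antidiagonal (n + k))
    simp only at h2
    linarith
  have hU1 : ∀ n, coeff n U ≤ 1 := by
    intro n
    induction n using Nat.strong_induction_on with | _ n ih => ?_
    rcases Nat.eq_zero_or_pos n with rfl | hn
    · have := congrArg constantCoeff hrec
      simp [hF0] at this
      simp [this]
    · rw [hrec, map_add, coeff_one, if_neg hn.ne', zero_add, coeff_mul,
        Finset.Nat.sum_antidiagonal_eq_sum_range_succ (fun i j => coeff i F * coeff j U)]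
      refine le_trans (Finset.sum_le_sum (g := fun i => coeff i F) fun i _ => ?_)
        (sum_le_hasSum _ (fun i _ => hF i) hsum)
      rcases Nat.eq_zero_or_pos i with rfl | hi
      · simp [hF0]
      · exact mul_le_of_le_one_right (hF i) (ih _ (by omega))
  -- `T j` is the tail of the step law. The tails have finite sum by the finite mean, and convolving
  -- them with `U` gives the constant sequence 1.
  set T : ℕ → ℝ := fun j => ∑' i, if j < i then coeff i F else 0 with hT
  have hTs : ∀ j, Summable fun i => if j < i then coeff i F else 0 := fun j =>
    Summable.of_nonneg_of_le (fun i => by split_ifs <;> simp [hF]) (fun i => by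
      split_ifs <;> simp [hF]) hsum.summable
  have hT0 : ∀ j, 0 ≤ T j := fun j => tsum_nonneg fun i => by split_ifs <;> simp [hF]
  have hTeq : ∀ j, T j + ∑ i ∈ Finset.range (j + 1), coeff i F = 1 := by
    intro j
    have h1 : ∑ i ∈ Finset.range (j + 1), coeff i F = ∑' i, if i ≤ j then coeff i F else 0 := by
      rw [tsum_eq_sum (s := Finset.range (j + 1))]
      · refine Finset.sum_congr rfl fun i hi => ?_
        rw [if_pos (by simpa [Nat.lt_succ_iff] using hi)]
      · intro i hi
        rw [if_neg (by simpa [Nat.lt_succ_iff] using hi)]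
    rw [h1, ← hsum.tsum_eq, ← (hTs j).tsum_add]
    · refine tsum_congr fun i => ?_
      by_cases h : j < i
      · simp [h, not_le.2 h]
      · simp [h, not_lt.1 h]
    · exact Summable.of_nonneg_of_le (fun i => by split_ifs <;> simp [hF]) (fun i => by
        split_ifs <;> simp [hF]) hsum.summable
  have hTsum : Summable T := by
    refine summable_of_sum_range_le (c := ∑' n : ℕ, (n : ℝ) * coeff n F) hT0 fun N => ?_
    rw [hT, ← Summable.tsum_finsetSum fun j _ => hTs j]
    have hle : ∀ i, ∑ j ∈ Finset.range N, (if j < i then coeff i F else 0) ≤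
        (i : ℝ) * coeff i F := by
      intro i
      rw [← Finset.sum_filter, Finset.sum_const, nsmul_eq_mul]
      gcongr
      · exact hF i
      · refine (Finset.card_le_card (t := Finset.range i) fun j hj => ?_).trans (by simp)
        simpa using (Finset.mem_filter.1 hj).2
    exact (summable_sum fun j _ => hTs j).tsum_le_tsum hle hmean
  have hTmul : mk T * (1 - X) = 1 - F := by
    ext n
    rw [mul_sub, mul_one, map_sub, map_sub]
    rcases n with _ | n
    · have := hTeq 0
      simp at this
      simp [hF0] at this ⊢
      linarith
    · have h1 := hTeq n
      have h2 := hTeq (n + 1)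
      rw [Finset.sum_range_succ] at h2
      rw [coeff_succ_mul_X, coeff_mk, coeff_mk, coeff_one, if_neg (Nat.succ_ne_zero n)]
      linarith
  have hconv : mk T * U = mk 1 := by
    have h1 : (mk 1 : ℝ⟦X⟧) * (1 - X) = 1 := mk_one_mul_one_sub_eq_one ℝ
    calc mk T * U = (mk T * (1 - X)) * U * mk 1 := by linear_combination (-(mk T * U)) * h1
      _ = mk 1 := by rw [hTmul, hFU, one_mul]
  have hone : ∀ n, ∑ j ∈ Finset.range (n + 1), T j * coeff (n - j) U = 1 := by
    intro n
    have := congrArg (coeff n) hconv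
    rw [coeff_mul, Finset.Nat.sum_antidiagonal_eq_sum_range_succ
      (fun i j => coeff i (mk T) * coeff j U)] at this
    simpa using this
  set S := ∑' j, T j with hS
  -- The terms with `j ≥ J` contribute at most `1/2` to `∑ T j * coeff (n - j) U = 1`. In the
  -- others, `coeff (n - j) U` is at most `coeff n U / coeff 1 F ^ J`, by following with `j` unit
  -- steps.
  obtain ⟨J, hJ⟩ : ∃ J, S - 1 / 2 < ∑ j ∈ Finset.range J, T j :=
    (hTsum.hasSum.tendsto_sum_nat.eventually_const_lt (by linarith)).exists
  have hF1' : coeff 1 F ≤ 1 := le_hasSum hsum 1 fun i _ => hF i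
  have hS0 : 0 < S := by
    have h0 := hTeq 0
    have : T 0 ≤ S := hTsum.le_tsum 0 fun j _ => hT0 j
    simp [hF0] at h0
    linarith
  refine ⟨coeff 1 F ^ J / (2 * S), by positivity, fun n => ?_⟩
  have hback : ∀ j m, coeff 1 F ^ j * coeff m U ≤ coeff (m + j) U := by
    intro j m
    induction j with
    | zero => simp
    | succ j ih =>
      calc coeff 1 F ^ (j + 1) * coeff m U = coeff 1 F * (coeff 1 F ^ j * coeff m U) := by ring
        _ ≤ coeff 1 F * coeff (m + j) U := by gcongr
        _ ≤ _ := hUF (m + j) 1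
  have hterm : ∀ j ∈ Finset.range (n + 1), T j * coeff (n - j) U ≤
      T j * (coeff n U / coeff 1 F ^ J) + if J ≤ j then T j else 0 := by
    intro j hj
    have hj' : j ≤ n := by simpa [Nat.lt_succ_iff] using hj
    have hM : 0 ≤ coeff n U / coeff 1 F ^ J := div_nonneg (hU n) (by positivity)
    split_ifs with h
    · have h1 := mul_le_of_le_one_right (hT0 j) (hU1 (n - j))
      have h2 := mul_nonneg (hT0 j) hM
      linarith
    · rw [add_zero]
      refine mul_le_mul_of_nonneg_left ?_ (hT0 j)
      rw [le_div_iff₀ (by positivity)]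
      have h1 := hback j (n - j)
      rw [Nat.sub_add_cancel hj'] at h1
      refine le_trans ?_ h1
      rw [mul_comm]
      exact mul_le_mul_of_nonneg_right (pow_le_pow_of_le_one hF1.le hF1' (by omega)) (hU _)
  have htail : ∑ j ∈ Finset.range (n + 1), (if J ≤ j then T j else 0) ≤ 1 / 2 := by
    rw [← Finset.sum_filter]
    have hd : Disjoint (Finset.range J) ((Finset.range (n + 1)).filter (J ≤ ·)) := by
      rw [Finset.disjoint_left]
      intro j hj hj'
      have := (Finset.mem_filter.1 hj').2
      rw [Finset.mem_range] at hj
      omega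
    have h1 := hTsum.sum_le_tsum (Finset.range J ∪ (Finset.range (n + 1)).filter (J ≤ ·))
      fun j _ => hT0 j
    rw [Finset.sum_union hd] at h1
    linarith
  have h1 := Finset.sum_le_sum hterm
  rw [hone, Finset.sum_add_distrib, ← Finset.sum_mul] at h1
  have h2 : (∑ j ∈ Finset.range (n + 1), T j) * (coeff n U / coeff 1 F ^ J) ≤
      S * (coeff n U / coeff 1 F ^ J) := by
    gcongr
    · exact div_nonneg (hU n) (by positivity)
    · exact hTsum.sum_le_tsum _ fun j _ => hT0 j
  have h3 : 1 / 2 ≤ S * (coeff n U / coeff 1 F ^ J) := by linarith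
  rw [mul_div_assoc', le_div_iff₀ (by positivity)] at h3
  rw [div_le_iff₀ (by positivity)]
  linarith

/-! ### The lower bound of order `n ^ (-3/2)` for the number of trees -/

namespace NonplaneTree

open PowerSeries

/-- The generating function of trees rescaled to have radius of convergence one. -/
noncomputable def scaledSeries : ℝ⟦X⟧ := mk fun n => (count n : ℝ) * rho ^ n

/-- The step distribution `2ζ(ρz)` with `ζ(z) = z + y(z²)/2`. -/
noncomputable def stepSeries : ℝ⟦X⟧ := 2 * scaledSeries - scaledSeries ^ 2

theorem coeff_stepSeries (n : ℕ) : coeff n stepSeries =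
    (if n = 1 then 2 * rho else 0) + if Even n then (count (n / 2) : ℝ) * rho ^ n else 0 := by
  have h2 : (2 : ℝ⟦X⟧) = C (2 : ℝ) := (map_ofNat C 2).symm
  have h : (2 * count n : ℝ) = 2 * (if n = 1 then 1 else 0) +
      (∑ p ∈ Finset.HasAntidiagonal.antidiagonal n, (count p.1 * count p.2 : ℝ) +
        if Even n then (count (n / 2) : ℝ) else 0) := by
    exact_mod_cast two_mul_count n
  have hs : ∑ p ∈ Finset.HasAntidiagonal.antidiagonal n,
      (count p.1 : ℝ) * rho ^ p.1 * ((count p.2 : ℝ) * rho ^ p.2) =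
      (∑ p ∈ Finset.HasAntidiagonal.antidiagonal n, (count p.1 * count p.2 : ℝ)) * rho ^ n := by
    rw [Finset.sum_mul]
    refine Finset.sum_congr rfl fun p hp => ?_
    rw [← Finset.HasAntidiagonal.mem_antidiagonal.1 hp, pow_add]
    ring
  rw [stepSeries, map_sub, h2, coeff_C_mul, sq, coeff_mul]
  simp only [scaledSeries, coeff_mk]
  rw [hs]
  have e : (if n = 1 then 2 * rho else 0) = 2 * (if n = 1 then 1 else 0) * rho ^ n := by
    split_ifs with h1
    · simp [h1]
    · simp
  have e' : (if Even n then (count (n / 2) : ℝ) * rho ^ n else 0) =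
      (if Even n then (count (n / 2) : ℝ) else 0) * rho ^ n := by
    split_ifs <;> simp
  rw [e, e']
  linear_combination rho ^ n * h

theorem coeff_stepSeries_nonneg (n : ℕ) : 0 ≤ coeff n stepSeries := by
  have := rho_pos
  rw [coeff_stepSeries]
  positivity

theorem constantCoeff_stepSeries : constantCoeff stepSeries = 0 := by
  rw [← coeff_zero_eq_constantCoeff_apply, coeff_stepSeries]
  simp [count_zero]

theorem coeff_one_stepSeries : coeff 1 stepSeries = 2 * rho := by
  rw [coeff_stepSeries]
  simp

theorem hasSum_even_iff {g : ℕ → ℝ} {a : ℝ} :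
    HasSum (fun n => if Even n then g n else 0) a ↔ HasSum (fun m => g (2 * m)) a := by
  have hinj : Function.Injective fun m : ℕ => 2 * m := fun a b h => by simpa using h
  rw [← hinj.hasSum_iff]
  · simp [Function.comp_def]
  · intro n hn
    rw [if_neg]
    rintro ⟨k, rfl⟩
    exact hn ⟨k, by simp [two_mul]⟩

theorem hasSum_stepSeries : HasSum (fun n => coeff n stepSeries) 1 := by
  simp_rw [coeff_stepSeries]
  rw [← two_mul_rho_add_genFun]
  refine (hasSum_ite_eq 1 (2 * rho)).add ?_
  rw [hasSum_even_iff (g := fun n => (count (n / 2) : ℝ) * rho ^ n)]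
  have := (summable_of_lt_rho (sq_nonneg rho) rho_sq_lt).hasSum
  simpa [pow_mul, genFun] using this

/-- The step law has finite mean because `y` is evaluated at `rho ^ 2`, strictly inside its disc of
convergence. -/
theorem summable_mul_stepSeries : Summable fun n : ℕ => (n : ℝ) * coeff n stepSeries := by
  simp_rw [coeff_stepSeries, mul_add]
  refine Summable.add ?_ ?_
  · exact summable_of_hasFiniteSupport <| (Set.finite_singleton 1).subset fun n hn => by
      by_contra h
      have : n ≠ 1 := h
      simp [this] at hn
  · obtain ⟨s, h1, h2⟩ := exists_between rho_sq_lt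
    have h := (summable_nat_mul_of_lt (fun n => (count n).cast_nonneg) (sq_nonneg rho) h1
      (summable_of_lt_rho ((sq_nonneg rho).trans h1.le) h2)).mul_left 2
    obtain ⟨a, ha⟩ := h
    refine ⟨a, ?_⟩
    simp_rw [mul_ite, mul_zero]
    rw [hasSum_even_iff (g := fun n : ℕ => (n : ℝ) * ((count (n / 2) : ℝ) * rho ^ n))]
    refine ha.congr_fun fun m => ?_
    simp [pow_mul]
    ring

theorem constantCoeff_scaledSeries : constantCoeff scaledSeries = 0 := by
  simp [scaledSeries, count_zero]

theorem subst_one_sub_mul (B : ℝ⟦X⟧) :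
    (B * (1 - X)).subst stepSeries = B.subst stepSeries * (1 - stepSeries) := by
  have hs : HasSubst stepSeries := HasSubst.of_constantCoeff_zero' constantCoeff_stepSeries
  rw [subst_mul hs, subst_sub hs, subst_X hs, ← coe_substAlgHom hs, map_one]

/-- The product squares to 1 because `1 - stepSeries = (1 - scaledSeries) ^ 2`; its constant term
excludes `-1`. -/
theorem subst_invSqrt_mul :
    invSqrtOneSub.subst stepSeries * (1 - scaledSeries) = 1 := by
  have hs : HasSubst stepSeries := HasSubst.of_constantCoeff_zero' constantCoeff_stepSeries
  have h := subst_one_sub_mul (invSqrtOneSub ^ 2)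
  rw [invSqrtOneSub_sq_mul, subst_pow hs, ← coe_substAlgHom hs, map_one, coe_substAlgHom hs] at h
  have h' : (invSqrtOneSub.subst stepSeries * (1 - scaledSeries)) ^ 2 = 1 := by
    have e : 1 - stepSeries = (1 - scaledSeries) ^ 2 := by rw [stepSeries]; ring
    rw [mul_pow, ← e]
    exact h.symm
  rcases sq_eq_one_iff.1 h' with h1 | h1
  · exact h1
  · have h0 := congrArg (coeff 0) h1
    rw [coeff_zero_eq_constantCoeff_apply, map_mul, ← coeff_zero_eq_constantCoeff_apply,
      coeff_subst_eq_sum constantCoeff_stepSeries] at h0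
    norm_num [invSqrtOneSub, constantCoeff_scaledSeries] at h0

theorem exists_pos_le_count :
    ∃ c > 0, ∀ n : ℕ, 1 ≤ n → c / (n : ℝ) ^ (3 / 2 : ℝ) ≤ (count n : ℝ) * rho ^ n := by
  have hρ := rho_pos
  have hF0 := constantCoeff_stepSeries
  have hs : HasSubst stepSeries := HasSubst.of_constantCoeff_zero' hF0
  have hU : (1 - stepSeries) * (mk 1 : ℝ⟦X⟧).subst stepSeries = 1 := by
    have h := subst_one_sub_mul (mk 1)
    rw [mk_one_mul_one_sub_eq_one, ← coe_substAlgHom hs, map_one, coe_substAlgHom hs] at h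
    rw [mul_comm, ← h]
  have hUc : ∀ n, coeff n ((mk 1 : ℝ⟦X⟧).subst stepSeries) =
      ∑ k ∈ Finset.range (n + 1), coeff n (stepSeries ^ k) := fun n => by
    rw [coeff_subst_eq_sum hF0]; simp
  have hpow := coeff_pow_nonneg coeff_stepSeries_nonneg
  obtain ⟨c, hc, hcU⟩ := exists_pos_le_renewal hU hF0 coeff_stepSeries_nonneg
    (by rw [coeff_one_stepSeries]; positivity) hasSum_stepSeries summable_mul_stepSeries
    (fun n => by rw [hUc]; exact Finset.sum_nonneg fun k _ => hpow k n)
  set V := invSqrtOneSub.subst stepSeries with hV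
  -- Only powers `k ≤ n` of the step series reach degree `n`, so each weight is at least `1 / (2
  -- √(n+1))`; what remains is the renewal sequence.
  have hVc : ∀ n : ℕ, c / (2 * √((n : ℝ) + 1)) ≤ coeff n V := by
    intro n
    rw [hV, coeff_subst_eq_sum hF0]
    calc c / (2 * √((n : ℝ) + 1))
        ≤ (∑ k ∈ Finset.range (n + 1), coeff n (stepSeries ^ k)) / (2 * √((n : ℝ) + 1)) := by
          gcongr
          rw [← hUc]
          exact hcU n
      _ = ∑ k ∈ Finset.range (n + 1), 1 / (2 * √((n : ℝ) + 1)) * coeff n (stepSeries ^ k) := by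
          rw [← Finset.mul_sum]; ring
      _ ≤ _ := by
          refine Finset.sum_le_sum fun k hk => mul_le_mul_of_nonneg_right ?_ (hpow k n)
          refine le_trans ?_ (inv_sqrt_le_coeff k)
          have : (k : ℝ) ≤ n := by exact_mod_cast Nat.lt_succ_iff.1 (Finset.mem_range.1 hk)
          gcongr
  have hV0 : ∀ n, 0 ≤ coeff n V := fun n => le_trans (by positivity) (hVc n)
  have hode : 2 * derivative ℝ scaledSeries = derivative ℝ stepSeries * V := by
    have h1 : derivative ℝ stepSeries = 2 * derivative ℝ scaledSeries * (1 - scaledSeries) := by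
      rw [stepSeries, map_sub, Derivation.leibniz_pow, two_mul, map_add]
      simp
      ring
    rw [h1]
    linear_combination (-2 * derivative ℝ scaledSeries) * subst_invSqrt_mul
  refine ⟨rho * c / 2, by positivity, fun N hN => ?_⟩
  obtain ⟨n, rfl⟩ := Nat.exists_eq_add_of_le' hN
  have hcoef := congrArg (coeff n) hode
  have h2 : (2 : ℝ⟦X⟧) = C (2 : ℝ) := (map_ofNat C 2).symm
  rw [h2, coeff_C_mul, coeff_mul] at hcoef
  -- All terms are nonnegative, and the one from the constant coefficient `2 * rho` of the
  -- derivative of `stepSeries` suffices.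
  have hsingle := Finset.single_le_sum
    (f := fun p : ℕ × ℕ => coeff p.1 (derivative ℝ stepSeries) * coeff p.2 V)
    (fun p _ => mul_nonneg (by
      rw [coeff_derivative]
      exact mul_nonneg (coeff_stepSeries_nonneg _) (by positivity)) (hV0 _))
    (Finset.HasAntidiagonal.mem_antidiagonal.2 (Nat.zero_add n) :
      (0, n) ∈ Finset.HasAntidiagonal.antidiagonal n)
  rw [← hcoef] at hsingle
  simp only [coeff_derivative, zero_add, coeff_one_stepSeries, Nat.cast_zero, mul_one,
    scaledSeries, coeff_mk] at hsingle
  have hVn := hVc n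
  have h3 : rho * (c / (2 * √((n : ℝ) + 1))) ≤
      (count (n + 1) : ℝ) * rho ^ (n + 1) * ((n : ℝ) + 1) := by
    have := mul_le_mul_of_nonneg_left hVn hρ.le
    linarith
  have h32 : ((n + 1 : ℕ) : ℝ) ^ (3 / 2 : ℝ) = ((n : ℝ) + 1) * √((n : ℝ) + 1) := by
    rw [show (3 / 2 : ℝ) = 1 + 1 / 2 by norm_num, Real.rpow_add (by positivity), Real.rpow_one,
      Real.sqrt_eq_rpow]
    push_cast
    rfl
  rw [h32]
  calc rho * c / 2 / (((n : ℝ) + 1) * √((n : ℝ) + 1))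
      = rho * (c / (2 * √((n : ℝ) + 1))) / ((n : ℝ) + 1) := by field_simp
    _ ≤ _ := by rw [div_le_iff₀ (by positivity)]; exact h3

end NonplaneTree

/-! ### Log-convexity and the saddle-point equation -/

namespace NonplaneTree

theorem genFun_pos {r : ℝ} (hr : 0 < r) (h : r < rho) : 0 < genFun r :=
  hr.trans_le (le_genFun hr.le h)

theorem summable_nat_mul {r : ℝ} (hr : 0 < r) (h : r < rho) :
    Summable fun n : ℕ => (n : ℝ) * ((count n : ℝ) * r ^ n) := by
  obtain ⟨s, h1, h2⟩ := exists_between h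
  exact summable_nat_mul_of_lt (fun n => (count n).cast_nonneg) hr.le h1
    (summable_of_lt_rho (hr.trans h1).le h2)

theorem mul_deriv_genFun {r : ℝ} (hr : 0 < r) (h : r < rho) :
    r * deriv genFun r = ∑' n : ℕ, (n : ℝ) * ((count n : ℝ) * r ^ n) := by
  rw [(hasDerivAt_genFun hr h).deriv, ← tsum_mul_left]
  refine tsum_congr fun n => ?_
  rcases n with _ | n
  · simp
  · rw [Nat.add_sub_cancel, pow_succ]
    ring

/-- The tangent inequality for the strictly convex function `u ↦ log y(exp u)`. -/
theorem rpow_mul_genFun_lt {r s : ℝ} (hr : 0 < r) (h : r < rho) (hs : 0 < s) (h' : s < rho)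
    (hne : r ≠ s) :
    (s / r) ^ (r * deriv genFun r / genFun r) * genFun r < genFun s := by
  have hy := genFun_pos hr h
  set A := r * deriv genFun r / genFun r with hA
  have ht : 0 < s / r := by positivity
  have hlog : Real.log (s / r) ≠ 0 := by
    refine Real.log_ne_zero_of_pos_of_ne_one ht fun h1 => hne ?_
    rw [div_eq_one_iff_eq hr.ne'] at h1
    exact h1.symm
  have hsum := (summable_of_lt_rho hr.le h).hasSum
  have hmean := (summable_nat_mul hr h).hasSum
  rw [← mul_deriv_genFun hr h] at hmean
  have hsum' := (summable_of_lt_rho hs.le h').hasSum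
  change HasSum _ (genFun r) at hsum
  change HasSum _ (genFun s) at hsum'
  have hAy : A * genFun r = r * deriv genFun r := by rw [hA]; field_simp
  have htot := hsum'.sub (((hsum.mul_left (1 - A * Real.log (s / r))).add
    (hmean.mul_left (Real.log (s / r)))).mul_left ((s / r) ^ A))
  have hval : (1 - A * Real.log (s / r)) * genFun r + Real.log (s / r) * (r * deriv genFun r) =
      genFun r := by rw [← hAy]; ring
  rw [hval] at htot
  -- `A` is the mean size under weights `count n * r ^ n`, so the linear terms cancel in the sum and
  -- each difference has the form `exp u - (u + 1)`, with `u = (n - A) log (s / r)`.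
  have hterm : ∀ n : ℕ, (count n : ℝ) * s ^ n - (s / r) ^ A *
      ((1 - A * Real.log (s / r)) * ((count n : ℝ) * r ^ n) +
        Real.log (s / r) * ((n : ℝ) * ((count n : ℝ) * r ^ n))) =
      (count n : ℝ) * r ^ n * (s / r) ^ A * (Real.exp (((n : ℝ) - A) * Real.log (s / r)) -
        (((n : ℝ) - A) * Real.log (s / r) + 1)) := by
    intro n
    have e : s ^ n = r ^ n * (s / r) ^ A * Real.exp (((n : ℝ) - A) * Real.log (s / r)) := by
      rw [Real.rpow_def_of_pos ht, mul_assoc, ← Real.exp_add,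
        show Real.log (s / r) * A + ((n : ℝ) - A) * Real.log (s / r) = n * Real.log (s / r) by ring,
        Real.exp_nat_mul, Real.exp_log ht, div_pow]
      field_simp
    rw [e]
    ring
  have hpos : ∀ n : ℕ, (n : ℝ) ≠ A → count n = 1 → 0 < (count n : ℝ) * r ^ n * (s / r) ^ A *
      (Real.exp (((n : ℝ) - A) * Real.log (s / r)) - (((n : ℝ) - A) * Real.log (s / r) + 1)) := by
    intro n hn hc
    have := Real.add_one_lt_exp (mul_ne_zero (sub_ne_zero.2 hn) hlog)
    rw [hc, Nat.cast_one]
    have := sub_pos.2 this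
    positivity
  simp_rw [hterm] at htot
  have hnn : ∀ n : ℕ, 0 ≤ (count n : ℝ) * r ^ n * (s / r) ^ A *
      (Real.exp (((n : ℝ) - A) * Real.log (s / r)) - (((n : ℝ) - A) * Real.log (s / r) + 1)) := by
    intro n
    have := sub_nonneg.2 (Real.add_one_le_exp (((n : ℝ) - A) * Real.log (s / r)))
    positivity
  rw [← sub_pos, ← htot.tsum_eq]
  -- Strictness needs one size `n ≠ A` that carries a tree; sizes 1 and 2 both do.
  by_cases h1 : A = 1
  · exact htot.summable.tsum_pos hnn 2 (hpos 2 (by rw [h1]; norm_num) count_two)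
  · exact htot.summable.tsum_pos hnn 1 (hpos 1 (by simpa using Ne.symm h1) count_one)

theorem log_genFun_add_lt {r s : ℝ} (hr : 0 < r) (h : r < rho) (hs : 0 < s) (h' : s < rho)
    (hne : r ≠ s) :
    Real.log (genFun r) + r * deriv genFun r / genFun r * (Real.log s - Real.log r) <
      Real.log (genFun s) := by
  have hy := genFun_pos hr h
  have key := Real.log_lt_log (by positivity) (rpow_mul_genFun_lt hr h hs h' hne)
  rw [Real.log_mul (by positivity) hy.ne', Real.log_rpow (by positivity),
    Real.log_div hs.ne' hr.ne'] at key
  linarith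

/-- With equal slopes, adding the strict tangent inequalities at `r` and at `s` gives a
contradiction. -/
theorem saddle_injective {r s : ℝ} (hr : 0 < r) (h : r < rho) (hs : 0 < s) (h' : s < rho)
    (heq : r * deriv genFun r / genFun r = s * deriv genFun s / genFun s) : r = s := by
  by_contra hne
  have h1 := log_genFun_add_lt hr h hs h' hne
  have h2 := log_genFun_add_lt hs h' hr h (Ne.symm hne)
  rw [← heq] at h2
  linarith

theorem deriv_genFun_nonneg {r : ℝ} (hr : 0 < r) (h : r < rho) : 0 ≤ deriv genFun r := by
  rw [(hasDerivAt_genFun hr h).deriv]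
  exact tsum_nonneg fun n => by positivity

/-- Differentiating `(1 - y)^2 = 1 - 2 z - y(z^2)` gives `(1 - y(r)) y'(r) = 1 + r y'(r^2)`. Hence
`y'` blows up where `y` approaches 1. -/
theorem one_le_one_sub_mul_deriv {r : ℝ} (hr : 0 < r) (h : r < rho) :
    1 ≤ (1 - genFun r) * deriv genFun r := by
  have hr2 := sq_lt_rho hr.le h
  have hd := ((analyticAt_genFun hr.le h).differentiableAt).hasDerivAt
  have hd2 := ((analyticAt_genFun (sq_nonneg r) hr2).differentiableAt).hasDerivAt
  have h1 := (hd.const_sub 1).pow 2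
  have h2 := (((hasDerivAt_id r).const_mul 2).const_sub 1).sub
    (HasDerivAt.comp (h := fun z : ℝ => z ^ 2) r hd2 (hasDerivAt_pow 2 r))
  have heq : (fun z => (1 - genFun z) ^ 2) =ᶠ[𝓝 r]
      fun z => (1 - 2 * id z) - (genFun ∘ fun z => z ^ 2) z := by
    filter_upwards [Ioo_mem_nhds hr h] with z hz
    exact genFun_sq_eq hz.1.le (summable_of_lt_rho hz.1.le hz.2)
  have key := (h1.congr_of_eventuallyEq heq.symm).unique h2
  have := mul_nonneg (deriv_genFun_nonneg (by positivity : 0 < r ^ 2) hr2) hr.le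
  norm_num at key
  linarith

theorem exists_saddle_lt {a : ℝ} (ha : 1 < a) :
    ∃ r ∈ Set.Ioo 0 rho, r * deriv genFun r / genFun r < a := by
  have h0 : deriv genFun 0 = 1 := by
    rw [hasFPowerSeriesOnBall_genFun.hasFPowerSeriesAt.deriv]
    simp [count_one]
  have hc : ContinuousAt (deriv genFun) 0 :=
    ((analyticAt_genFun le_rfl rho_pos).deriv).continuousAt
  have hev : ∀ᶠ r in 𝓝[>] (0 : ℝ), deriv genFun r < a :=
    (hc.tendsto.mono_left nhdsWithin_le_nhds).eventually_lt_const (by rwa [h0])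
  obtain ⟨r, hra, hr⟩ := (hev.and (Ioo_mem_nhdsGT rho_pos)).exists
  refine ⟨r, hr, lt_of_le_of_lt ?_ hra⟩
  rw [div_le_iff₀ (genFun_pos hr.1 hr.2), mul_comm]
  exact mul_le_mul_of_nonneg_left (le_genFun hr.1.le hr.2) (deriv_genFun_nonneg hr.1 hr.2)

theorem exists_lt_saddle {a : ℝ} (ha : 0 < a) :
    ∃ r ∈ Set.Ioo 0 rho, a < r * deriv genFun r / genFun r := by
  have hρ := rho_pos
  have hcont : ContinuousAt (fun r => 1 - 2 * r - genFun (r ^ 2)) rho := by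
    have h1 : ContinuousAt genFun (rho ^ 2) :=
      (analyticAt_genFun (sq_nonneg _) rho_sq_lt).continuousAt
    have h2 : ContinuousAt (fun r => genFun (r ^ 2)) rho :=
      ContinuousAt.comp' (f := fun r : ℝ => r ^ 2) h1 (by fun_prop)
    fun_prop
  -- The constant makes `1 - y(r) < rho / (2 a)`, hence `y'(r) > 2 a / rho`; with `r > rho / 2` and
  -- `y(r) < 1` the ratio exceeds `a`.
  have hlim : ∀ᶠ r in 𝓝[<] rho, 1 - 2 * r - genFun (r ^ 2) < (rho / (2 * a)) ^ 2 :=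
    (hcont.tendsto.mono_left nhdsWithin_le_nhds).eventually_lt_const (by
      have := two_mul_rho_add_genFun
      have h2 : 0 < (rho / (2 * a)) ^ 2 := by positivity
      linarith)
  obtain ⟨r, hr1, hr⟩ := (hlim.and (Ioo_mem_nhdsLT (show rho / 2 < rho by linarith))).exists
  have hr0 : 0 < r := by linarith [hr.1]
  have hy := genFun_pos hr0 hr.2
  have hy1 := genFun_lt_one hr0.le hr.2
  refine ⟨r, ⟨hr0, hr.2⟩, ?_⟩
  rw [← genFun_sq_eq hr0.le (summable_of_lt_rho hr0.le hr.2)] at hr1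
  have hlt : 1 - genFun r < rho / (2 * a) := lt_of_pow_lt_pow_left₀ 2 (by positivity) hr1
  have hd := one_le_one_sub_mul_deriv hr0 hr.2
  have hd0 : 0 < deriv genFun r := by
    by_contra! hle
    nlinarith
  have h1 : 1 < rho / (2 * a) * deriv genFun r :=
    hd.trans_lt (mul_lt_mul_of_pos_right hlt hd0)
  have h2 : a < rho / 2 * deriv genFun r := by
    have := mul_lt_mul_of_pos_left h1 ha
    have e : a * (rho / (2 * a) * deriv genFun r) = rho / 2 * deriv genFun r := by field_simp
    linarith
  have h3 : rho / 2 * deriv genFun r ≤ r * deriv genFun r := by gcongr; exact hr.1.le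
  rw [lt_div_iff₀ hy]
  nlinarith

theorem exists_saddle {x : ℝ} (hx : x ∈ Set.Ioo (0 : ℝ) 1) :
    ∃ ξ ∈ Set.Ioo 0 rho, x * ξ * deriv genFun ξ = genFun ξ := by
  have hcont : ContinuousOn (fun r => r * deriv genFun r / genFun r) (Set.Ioo 0 rho) := by
    intro r hr
    have ha := analyticAt_genFun hr.1.le hr.2
    exact ((continuousAt_id.mul ha.deriv.continuousAt).div ha.continuousAt
      (genFun_pos hr.1 hr.2).ne').continuousWithinAt
  obtain ⟨r, hr, h1⟩ := exists_saddle_lt (one_lt_inv_iff₀.2 hx)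
  obtain ⟨s, hs, h2⟩ := exists_lt_saddle (inv_pos.2 hx.1)
  obtain ⟨ξ, hξ, h⟩ := isPreconnected_Ioo.intermediate_value hr hs hcont ⟨h1.le, h2.le⟩
  refine ⟨ξ, hξ, ?_⟩
  have hy := genFun_pos hξ.1 hξ.2
  have hx0 := hx.1
  simp only at h
  field_simp at h
  linarith

/-! ### The rate function -/

/-- The rate function of the height, as a Legendre transform. -/
noncomputable def rate (x : ℝ) : ℝ :=
  (⨆ r : Set.Ioo 0 rho, (Real.log r - x * Real.log (genFun r))) - Real.log rho

instance : Nonempty (Set.Ioo 0 rho) := (Set.nonempty_Ioo.2 rho_pos).to_subtype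

theorem log_genFun_neg {r : ℝ} (hr : r ∈ Set.Ioo 0 rho) : Real.log (genFun r) < 0 :=
  Real.log_neg (genFun_pos hr.1 hr.2) (genFun_lt_one hr.1.le hr.2)

theorem log_sub_le_zero {x : ℝ} (hx : x ≤ 1) {r : ℝ} (hr : r ∈ Set.Ioo 0 rho) :
    Real.log r - x * Real.log (genFun r) ≤ 0 := by
  have h1 := Real.log_le_log hr.1 (le_genFun hr.1.le hr.2)
  nlinarith [log_genFun_neg hr]

theorem le_rate {x : ℝ} (hx : x ≤ 1) {r : ℝ} (hr : r ∈ Set.Ioo 0 rho) :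
    Real.log r - x * Real.log (genFun r) - Real.log rho ≤ rate x := by
  have hb : BddAbove (Set.range fun r : Set.Ioo 0 rho =>
      Real.log r - x * Real.log (genFun r)) := by
    refine ⟨0, ?_⟩
    rintro _ ⟨r, rfl⟩
    exact log_sub_le_zero hx r.2
  exact sub_le_sub_right (le_ciSup hb ⟨r, hr⟩) _

theorem rate_le {x M : ℝ}
    (h : ∀ r ∈ Set.Ioo 0 rho, Real.log r - x * Real.log (genFun r) - Real.log rho ≤ M) :
    rate x ≤ M := by
  rw [rate, sub_le_iff_le_add]
  exact ciSup_le fun r => by linarith [h r r.2]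

theorem exists_lt_of_lt_rate {x a : ℝ} (h : a < rate x) :
    ∃ r ∈ Set.Ioo 0 rho, a < Real.log r - x * Real.log (genFun r) - Real.log rho := by
  by_contra! hle
  exact absurd (rate_le hle) (not_le.2 h)

/-- The saddle-point equation says that `x` times the logarithmic slope at `ξ` is 1, so the tangent
inequality multiplied by `x` says that `ξ` maximises. -/
theorem rate_eq {x ξ : ℝ} (hx1 : x < 1) (hξ : ξ ∈ Set.Ioo 0 rho)
    (h : x * ξ * deriv genFun ξ = genFun ξ) :
    rate x = Real.log ξ - x * Real.log (genFun ξ) - Real.log rho := by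
  refine le_antisymm (rate_le fun r hr => ?_) (le_rate hx1.le hξ)
  rcases eq_or_ne ξ r with rfl | hne
  · exact le_rfl
  · have hy := genFun_pos hξ.1 hξ.2
    have hx0 : 0 ≤ x := by
      by_contra! hlt
      have := mul_nonneg hξ.1.le (deriv_genFun_nonneg hξ.1 hξ.2)
      nlinarith
    have key := mul_le_mul_of_nonneg_left (log_genFun_add_lt hξ.1 hξ.2 hr.1 hr.2 hne).le hx0
    have e : x * (ξ * deriv genFun ξ / genFun ξ) = 1 := by
      rw [← mul_div_assoc, div_eq_one_iff_eq hy.ne', ← mul_assoc, h]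
    have e2 : x * (Real.log (genFun ξ) + ξ * deriv genFun ξ / genFun ξ *
        (Real.log r - Real.log ξ)) = x * Real.log (genFun ξ) + (Real.log r - Real.log ξ) := by
      linear_combination (Real.log r - Real.log ξ) * e
    linarith

theorem rate_mono {x x' : ℝ} (h : x ≤ x') (hx' : x' ≤ 1) : rate x ≤ rate x' :=
  rate_le fun r hr => le_trans (by nlinarith [log_genFun_neg hr]) (le_rate hx' hr)

/-- The supremum at `x` is attained at a saddle point, and the affine function there has slope `-log
y(ξ) > 0`. -/
theorem rate_lt_rate {x x' : ℝ} (hx : x ∈ Set.Ioo (0 : ℝ) 1) (h : x < x') (hx' : x' ≤ 1) :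
    rate x < rate x' := by
  obtain ⟨ξ, hξ, hs⟩ := exists_saddle hx
  rw [rate_eq hx.2 hξ hs]
  exact lt_of_lt_of_le (by nlinarith [log_genFun_neg hξ]) (le_rate hx' hξ)

theorem strictMonoOn_rate : StrictMonoOn rate (Set.Icc 0 1) := by
  intro x hx x' hx' h
  obtain ⟨a, h1, h2⟩ := exists_between h
  exact (rate_mono h1.le (h2.le.trans hx'.2)).trans_lt
    (rate_lt_rate ⟨hx.1.trans_lt h1, h2.trans_le hx'.2⟩ h2 hx'.2)

theorem rate_zero : rate 0 = 0 := by
  refine le_antisymm (rate_le fun r hr => ?_) ?_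
  · linarith [Real.log_le_log hr.1 hr.2.le]
  · have hc : Tendsto (fun r => Real.log r - Real.log rho) (𝓝[<] rho) (𝓝 0) := by
      have := ((Real.continuousAt_log rho_pos.ne').tendsto.sub_const (Real.log rho)).mono_left
        (nhdsWithin_le_nhds (s := Set.Iio rho))
      rwa [sub_self] at this
    refine le_of_tendsto hc ?_
    filter_upwards [Ioo_mem_nhdsLT rho_pos] with r hr
    simpa using le_rate zero_le_one hr

theorem convexOn_rate : ConvexOn ℝ (Set.Icc 0 1) rate := by
  refine ⟨convex_Icc 0 1, fun x hx y hy a b ha hb hab => rate_le fun r hr => ?_⟩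
  have h1 := mul_le_mul_of_nonneg_left (le_rate hx.2 hr) ha
  have h2 := mul_le_mul_of_nonneg_left (le_rate hy.2 hr) hb
  simp only [smul_eq_mul]
  have e : Real.log r - (a * x + b * y) * Real.log (genFun r) - Real.log rho =
      a * (Real.log r - x * Real.log (genFun r) - Real.log rho) +
      b * (Real.log r - y * Real.log (genFun r) - Real.log rho) := by
    linear_combination (Real.log rho - Real.log r) * hab
  linarith

/-- Convexity handles the interior, and the chord to 1 squeezes at 0. At 1, monotonicity bounds from
above and a nearly optimal affine function from below. -/
theorem continuousOn_rate : ContinuousOn rate (Set.Icc 0 1) := by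
  intro x hx
  rcases eq_or_lt_of_le hx.1 with rfl | h0
  · rw [ContinuousWithinAt, rate_zero]
    have hlim : Tendsto (fun x : ℝ => x * rate 1) (𝓝[Set.Icc 0 1] 0) (𝓝 0) := by
      have : Tendsto (fun x : ℝ => x * rate 1) (𝓝 0) (𝓝 (0 * rate 1)) :=
        (continuous_id.mul continuous_const).tendsto 0
      rw [zero_mul] at this
      exact this.mono_left nhdsWithin_le_nhds
    refine squeeze_zero' ?_ ?_ hlim
    · filter_upwards [self_mem_nhdsWithin] with x hx
      rw [← rate_zero]
      exact rate_mono hx.1 hx.2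
    · filter_upwards [self_mem_nhdsWithin] with x hx
      have := convexOn_rate.2 (Set.left_mem_Icc.2 zero_le_one) (Set.right_mem_Icc.2 zero_le_one)
        (sub_nonneg.2 hx.2) hx.1 (by ring)
      simpa [rate_zero] using this
  · rcases eq_or_lt_of_le hx.2 with rfl | h1
    · refine tendsto_order.2 ⟨fun a ha => ?_, fun a ha => ?_⟩
      · obtain ⟨r, hr, hlt⟩ := exists_lt_of_lt_rate ha
        have hc : Continuous fun x : ℝ =>
            Real.log r - x * Real.log (genFun r) - Real.log rho := by fun_prop
        filter_upwards [self_mem_nhdsWithin,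
          nhdsWithin_le_nhds ((hc.tendsto 1).eventually_const_lt hlt)] with x hx hax
        exact hax.trans_le (le_rate hx.2 hr)
      · filter_upwards [self_mem_nhdsWithin] with x hx
        exact (rate_mono hx.2 le_rfl).trans_lt ha
    · have := (convexOn_rate.subset Set.Ioo_subset_Icc_self (convex_Ioo 0 1)).continuousOn
        isOpen_Ioo
      exact (this.continuousAt (Ioo_mem_nhds h0 h1)).continuousWithinAt

/-! ### The Chernoff bound and the conclusion -/

theorem ncard_mul_pow_le {r : ℝ} (hr : r ∈ Set.Ioo 0 rho) (n k : ℕ) :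
    ((ofSize n ∩ {t | k ≤ t.height}).ncard : ℝ) * r ^ n ≤ genFun r ^ k * Real.exp 1 := by
  have hy := genFun_nonneg hr.1.le
  have hfin : (ofSize n ∩ {t | k ≤ t.height}).Finite := (finite_ofSize n).inter_of_left _
  have h : ((ofSize n ∩ {t | k ≤ t.height}).ncard : ℝ≥0∞) * ENNReal.ofReal r ^ n ≤
      gfGe k (ENNReal.ofReal r) := by
    have e := ENNReal.tsum_set_const (ofSize n ∩ {t | k ≤ t.height}) (ENNReal.ofReal r ^ n)
    rw [← hfin.cast_ncard_eq] at e
    rw [ENat.toENNReal_coe] at e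
    rw [← e, tsum_subtype (ofSize n ∩ {t | k ≤ t.height}) fun _ => ENNReal.ofReal r ^ n, gfGe]
    refine ENNReal.tsum_le_tsum fun t => ?_
    by_cases ht : t ∈ ofSize n ∩ {t | k ≤ t.height}
    · rw [Set.indicator_of_mem ht, if_pos (show k ≤ t.height from ht.2), show t.size = n from ht.1]
    · rw [Set.indicator_of_notMem ht]
      exact zero_le
  have h2 := h.trans (gfGe_le_exp_one hr.1.le hr.2 k)
  rw [← ENNReal.ofReal_natCast, ← ENNReal.ofReal_pow hr.1.le,
    ← ENNReal.ofReal_mul (by positivity),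
    ENNReal.ofReal_le_ofReal_iff (by positivity)] at h2
  exact h2

theorem uniformLaw_real (n : ℕ) (A : Set NonplaneTree) :
    (uniformLaw n).real A = ((ofSize n ∩ A).ncard : ℝ) / count n := by
  have h : ∀ s : Set NonplaneTree, s.Finite → Measure.count s = (s.ncard : ℝ≥0∞) := by
    intro s hs
    rw [Measure.count_apply (MeasurableSet.of_discrete), ← hs.cast_ncard_eq]
    rfl
  rw [measureReal_def, uniformLaw, uniformOn, cond_apply (MeasurableSet.of_discrete),
    h _ (finite_ofSize n), h _ ((finite_ofSize n).inter_of_left _)]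
  simp [count, div_eq_inv_mul]

theorem exists_uniformLaw_le :
    ∃ K : ℝ, ∀ x ∈ Set.Ioo (0 : ℝ) 1, ∀ n : ℕ, 1 ≤ n →
      (uniformLaw n).real {t | x * (n : ℝ) ≤ (t.height : ℝ)} ≤
        K * (n : ℝ) ^ (3 / 2 : ℝ) * Real.exp (-((n : ℝ) * rate x)) := by
  obtain ⟨c, hc, hlow⟩ := exists_pos_le_count
  -- `e` comes from the bound on tall trees and `c` from the count; neither depends on `x`, so one
  -- constant serves every `δ`.
  refine ⟨Real.exp 1 / c, fun x hx n hn => ?_⟩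
  obtain ⟨ξ, hξ, hs⟩ := exists_saddle hx
  have hξ0 := hξ.1
  have hρ := rho_pos
  have hy := genFun_pos hξ.1 hξ.2
  have hn0 : (0 : ℝ) < n := by exact_mod_cast hn
  have hset : {t : NonplaneTree | x * (n : ℝ) ≤ (t.height : ℝ)} =
      {t | ⌈x * (n : ℝ)⌉₊ ≤ t.height} := by
    ext t
    exact (Nat.ceil_le (a := x * (n : ℝ))).symm
  rw [uniformLaw_real, hset]
  have hup := ncard_mul_pow_le hξ n ⌈x * (n : ℝ)⌉₊
  -- Rounding the exponent up is harmless because `y(ξ) < 1`.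
  have hpow : genFun ξ ^ ⌈x * (n : ℝ)⌉₊ ≤ genFun ξ ^ (x * (n : ℝ)) := by
    rw [← Real.rpow_natCast]
    exact Real.rpow_le_rpow_of_exponent_ge hy (genFun_lt_one hξ.1.le hξ.2).le (Nat.le_ceil _)
  have hcn := hlow n hn
  have hcount : 0 < (count n : ℝ) := by
    have : 0 < (count n : ℝ) * rho ^ n := lt_of_lt_of_le (by positivity) hcn
    exact pos_of_mul_pos_left this (by positivity)
  have hexp : Real.exp (-((n : ℝ) * rate x)) = genFun ξ ^ (x * (n : ℝ)) * rho ^ n / ξ ^ n := by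
    rw [rate_eq hx.2 hξ hs, Real.rpow_def_of_pos hy, ← Real.exp_log hρ, ← Real.exp_nat_mul,
      Real.exp_log hρ, ← Real.exp_log hξ.1, ← Real.exp_nat_mul, Real.exp_log hξ.1, ← Real.exp_add,
      ← Real.exp_sub]
    congr 1
    ring
  rw [hexp, div_le_iff₀ hcount]
  rw [← le_div_iff₀ (by positivity)] at hup
  refine hup.trans ?_
  rw [div_le_iff₀ (by positivity)] at hcn
  calc genFun ξ ^ ⌈x * (n : ℝ)⌉₊ * Real.exp 1 / ξ ^ n
      ≤ genFun ξ ^ (x * (n : ℝ)) * Real.exp 1 / ξ ^ n := by gcongr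
    _ = genFun ξ ^ (x * (n : ℝ)) * Real.exp 1 / ξ ^ n / c * c := by field_simp
    _ ≤ genFun ξ ^ (x * (n : ℝ)) * Real.exp 1 / ξ ^ n / c *
        ((count n : ℝ) * rho ^ n * (n : ℝ) ^ (3 / 2 : ℝ)) := by gcongr
    _ = _ := by ring

end NonplaneTree

theorem mainTheorem9 :
    ∃ I : ℝ → ℝ,
      ContinuousOn I (Set.Icc 0 1) ∧
      StrictMonoOn I (Set.Icc 0 1) ∧
      (∀ u : ℝ, 0 < u → u ≤ 1 → 0 < I u) ∧
      (∀ x ∈ Set.Ioo (0 : ℝ) 1,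
        ∃ ξ ∈ Set.Ioo 0 NonplaneTree.rho,
          x * ξ * deriv NonplaneTree.genFun ξ = NonplaneTree.genFun ξ ∧
          (∀ r ∈ Set.Ioo 0 NonplaneTree.rho,
            x * r * deriv NonplaneTree.genFun r = NonplaneTree.genFun r → r = ξ) ∧
          I x = Real.log ξ - Real.log NonplaneTree.rho -
            x * Real.log (NonplaneTree.genFun ξ)) ∧
      (∀ δ : ℝ, 0 < δ → ∃ K : ℝ, ∀ x ∈ Set.Icc δ (1 - δ), ∀ n : ℕ, 1 ≤ n →
        (NonplaneTree.uniformLaw n).real {t | x * (n : ℝ) ≤ (t.height : ℝ)} ≤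
          K * (n : ℝ) ^ (3 / 2 : ℝ) * Real.exp (-((n : ℝ) * I x))) := by
  refine ⟨NonplaneTree.rate, NonplaneTree.continuousOn_rate, NonplaneTree.strictMonoOn_rate,
    fun u hu hu1 => ?_, fun x hx => ?_, fun δ hδ => ?_⟩
  · rw [← NonplaneTree.rate_zero]
    exact NonplaneTree.strictMonoOn_rate (Set.left_mem_Icc.2 zero_le_one) ⟨hu.le, hu1⟩ hu
  · obtain ⟨ξ, hξ, h⟩ := NonplaneTree.exists_saddle hx
    refine ⟨ξ, hξ, h, fun r hr h' => ?_, ?_⟩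
    · have key : ∀ s ∈ Set.Ioo 0 NonplaneTree.rho,
          x * s * deriv NonplaneTree.genFun s = NonplaneTree.genFun s →
          s * deriv NonplaneTree.genFun s / NonplaneTree.genFun s = x⁻¹ := by
        intro s hs e
        have hx0 := hx.1
        have := NonplaneTree.genFun_pos hs.1 hs.2
        field_simp
        linarith
      exact NonplaneTree.saddle_injective hr.1 hr.2 hξ.1 hξ.2 ((key r hr h').trans (key ξ hξ h).symm)
    · rw [NonplaneTree.rate_eq hx.2 hξ h]
      ring
  · obtain ⟨K, hK⟩ := NonplaneTree.exists_uniformLaw_le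
    exact ⟨K, fun x hx => hK x ⟨hδ.trans_le hx.1, hx.2.trans_lt (by linarith)⟩⟩
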